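/- Let $G,H$ be $\sigma$-compact locally compact (Hausdorff) abelian groups with Haar measures $m_G,m_H$, and let $\widetilde L\subset G\times H$ be a lattice (a discrete cocompact subgroup) such that the projection $G\times H\to G$ is one-to-one on $\widetilde L$ and the projection of $\widetilde L$ to $H$ is dense in $H$. Let $\mathbb T:=(G\times H)/\widetilde L$, with quotient map $(s,k)\mapsto[s,k]$, and let $\rho$ be an $\widetilde L$-invariant complex Radon measure on $G\times H$ (not necessarily finite), with total variation $|\rho|$. For an $\widetilde L$-invariant complex Radon measure $\sigma$ on $G\times H$ there is a unique complex measure $\sigma_{\mathbb T}$ on $\mathbb T$ with $$\int_{G\times H} g\,d\sigma=\int_{\mathbb T}\sum_{x\in\xi}g(x)\,d\sigma_{\mathbb T}(\xi)\qquad\text{for all } g\in C_c(G\times H);$$ this is applied to $\sigma=\rho$ and to $\sigma=m_G\times m_H$, and $(m_G\times m_H)_{\mathbb T}(1)\neq0$. A function $f:H\to\mathbb C$ is called admissible if it is Borel measurable, locally bounded, and for all $\varepsilon>0$ and $\varphi\in C_c(G)$ there is a compact $Q\subset H$ with $$\int_{G\times H}|\varphi(t+s)f(h+k)|\,(1-1_Q(h+k))\,d|\rho|(t,h)\le\varepsilon\qquad\text{for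 all }(s,k)\in G\times H.$$ A function $f:H\to\mathbb R$ is called Riemann integrable if for every $\varepsilon>0$ there are real $\varphi,\psi\in C_c(H)$ with $\varphi\le f\le\psi$ and $\int_H(\psi-\varphi)\,dm_H\le\varepsilon$. A van Hove sequence in $G$ is a sequence $(B_n)$ of relatively compact Borel sets of positive measure with $m_G(\partial^KB_n)/m_G(B_n)\to0$ for every compact $K\subset G$, where $\partial^KA:=((K+A)\setminus A^\circ)\cup((-K+\overline{G\setminus A})\cap A)$. Assume that one of the following holds: (1) $f\in C_c(H)$ (complex-valued); (2) $f:H\to\mathbb C$ is continuous and admissible; (3) $\rho\ge0$, and $f:H\to\mathbb R$ is Riemann integrable and such that $(t,h)\mapsto f(h+k)$ is $\rho$-measurable for every $k\in H$ (for instance, $f$ is Borel). Then $f$ is $m_H$-integrable (in case (2) provided that $\rho\ne0$). Moreover, for every van Hove sequence $(B_n)$ in $G$ the integrals $$\mu(\xi)(\chi_{B_n}):=\int_{G\times H}f(h+k)\,\chi_{B_n}(t+s)\,d\rho(t,h),\qquad \xi=[s,k]\in\mathbb T,$$ exist and depend only on $\xi$, and $$\lim_{n\to\infty}\frac{1}{m_G(B_n)}\,\mu(\xi)(\chi_{B_n})=\frac{\rho_{\mathbb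 T}(1)}{(m_G\times m_H)_{\mathbb T}(1)}\int_Hf\,dm_H$$ uniformly in $\xi\in\mathbb T$. (If $\rho=0$, both sides are read as $0$.) -/

import Mathlib

open MeasureTheory Filter Topology Set
open scoped Pointwise CompactlySupported

/-- A complex Radon measure `ρ` on a (σ-compact) locally compact Hausdorff space, in polar form
`ρ = phase · |ρ|`: its total variation `|ρ|` is a positive regular Borel measure, finite on compact
sets but possibly of infinite total mass, and `phase` is a Borel function of modulus one.
These are the locally bounded linear functionals on `C_c(X, ℂ)`.
The σ-algebra is the Borel σ-algebra of `X`; for a product of spaces that are not second countable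
it may be larger than the product σ-algebra. -/
structure ComplexRadonMeasure (X : Type*) [TopologicalSpace X] where
  variation : @Measure X (borel X)
  regular : @Measure.Regular X (borel X) _ variation
  phase : X → ℂ
  measurable_phase : @Measurable X ℂ (borel X) _ phase
  norm_phase : ∀ x, ‖phase x‖ = 1

namespace ComplexRadonMeasure

variable {X : Type*} [TopologicalSpace X]

/-- `F` is integrable with respect to `ρ`, that is, with respect to `|ρ|`. -/
def IntegrableFun (ρ : ComplexRadonMeasure X) (F : X → ℂ) : Prop :=
  Integrable F ρ.variation

/-- `ρ(F) = ∫ F dρ`. -/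
noncomputable def integral (ρ : ComplexRadonMeasure X) (F : X → ℂ) : ℂ :=
  @MeasureTheory.integral X ℂ _ _ (borel X) ρ.variation (fun x => F x * ρ.phase x)

/-- `ρ` is invariant under translations by elements of the subgroup `L`. -/
def IsInvariant [AddGroup X] (ρ : ComplexRadonMeasure X) (L : AddSubgroup X) : Prop :=
  ∀ l ∈ L, ∀ g : C_c(X, ℂ), ρ.integral (fun x => g (x + l)) = ρ.integral g

/-- `ρ ≥ 0`, that is, `ρ = |ρ|`. -/
def IsPositive (ρ : ComplexRadonMeasure X) : Prop :=
  ∀ᵐ x ∂ρ.variation, ρ.phase x = 1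

end ComplexRadonMeasure

/-- A cut and project scheme: `lattice` is a discrete cocompact subgroup of `G × H` on which the
projection to `G` is one-to-one and whose projection to `H` is dense. -/
structure CutProjectScheme (G H : Type*) [AddCommGroup G] [TopologicalSpace G]
    [AddCommGroup H] [TopologicalSpace H] where
  lattice : AddSubgroup (G × H)
  discrete : DiscreteTopology lattice
  cocompact : CompactSpace ((G × H) ⧸ lattice)
  injOn_fst : Set.InjOn (Prod.fst : G × H → G) (lattice : Set (G × H))
  dense_snd : Dense ((Prod.snd : G × H → H) '' (lattice : Set (G × H)))

namespace CutProjectScheme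

variable {G H : Type*} [AddCommGroup G] [TopologicalSpace G] [AddCommGroup H] [TopologicalSpace H]

/-- The compact group `𝕋 = (G × H) / lattice`. -/
abbrev Torus (S : CutProjectScheme G H) : Type _ := (G × H) ⧸ S.lattice

/-- `σ_ξ(g)`: the sum of `g` over the coset `ξ`. -/
noncomputable def cosetSum (S : CutProjectScheme G H) (g : C_c(G × H, ℂ)) (ξ : S.Torus) : ℂ :=
  ∑' y : {y : G × H // (QuotientAddGroup.mk y : S.Torus) = ξ}, g y

theorem cosetSum_mk (S : CutProjectScheme G H) (g : C_c(G × H, ℂ)) (x : G × H) :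
    S.cosetSum g (QuotientAddGroup.mk x) = ∑' l : S.lattice, g (x + l) := by
  let e : S.lattice ≃
      {y : G × H // (QuotientAddGroup.mk y : S.Torus) = QuotientAddGroup.mk x} :=
    { toFun := fun l => ⟨x + l, by simp⟩
      invFun := fun y => ⟨-x + y, QuotientAddGroup.eq.1 y.2.symm⟩
      left_inv := fun l => by ext <;> simp
      right_inv := fun y => by ext <;> simp }
  exact (e.tsum_eq (fun y => g (y : G × H))).symm

theorem continuous_cosetSum [IsTopologicalAddGroup G] [LocallyCompactSpace G] [T2Space G]
    [IsTopologicalAddGroup H] [LocallyCompactSpace H] [T2Space H]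
    (S : CutProjectScheme G H) (g : C_c(G × H, ℂ)) : Continuous (S.cosetSum g) := by
  have := S.discrete
  have key : ∀ K : Set (G × H), IsCompact K →
      {l : S.lattice | ∃ x ∈ K, g (x + l) ≠ 0}.Finite := by
    intro K hK
    have hc : IsCompact (tsupport g - K) :=
      sub_eq_add_neg (tsupport g) K ▸ g.hasCompactSupport.isCompact.add hK.neg
    have ht := AddSubgroup.tendsto_coe_cofinite_of_discrete S.lattice ⟨S.discrete⟩
    have hf : {l : S.lattice | (l : G × H) ∈ tsupport g - K}.Finite := by
      have h := ht hc.compl_mem_cocompact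
      rw [mem_map, mem_cofinite] at h
      refine h.subset fun l hl => ?_
      simpa using hl
    refine hf.subset ?_
    rintro l ⟨x, hx, hl⟩
    exact ⟨x + l, subset_tsupport _ hl, x, hx, by simp⟩
  refine (QuotientAddGroup.isQuotientMap_mk (N := S.lattice)).continuous_iff.2 ?_
  have heq : S.cosetSum g ∘ (QuotientAddGroup.mk : G × H → S.Torus) =
      fun x => ∑ᶠ l : S.lattice, g (x + l) := by
    funext x
    rw [Function.comp_apply, cosetSum_mk, tsum_eq_finsum]
    exact (key {x} isCompact_singleton).subset fun l hl => ⟨x, rfl, hl⟩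
  rw [heq]
  refine continuous_finsum (fun l => g.continuous.comp (continuous_id.add continuous_const)) ?_
  intro x
  obtain ⟨K, hK, hx⟩ := exists_compact_mem_nhds x
  exact ⟨K, hx, (key K hK).subset fun l ⟨y, hy, hyK⟩ => ⟨y, hyK, hy⟩⟩

/-- The continuous function `ξ ↦ σ_ξ(g)` on `𝕋`. -/
noncomputable def cosetSumMap [IsTopologicalAddGroup G] [LocallyCompactSpace G] [T2Space G]
    [IsTopologicalAddGroup H] [LocallyCompactSpace H] [T2Space H]
    (S : CutProjectScheme G H) (g : C_c(G × H, ℂ)) : C(S.Torus, ℂ) :=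
  ⟨S.cosetSum g, S.continuous_cosetSum g⟩

/-- The complex measure `J` on the compact group `𝕋` (a continuous linear functional on `C(𝕋)`)
disintegrates the functional `I` on `C_c(G × H)`: one has `I(g) = ∫_𝕋 σ_ξ(g) dJ(ξ)` for all `g`.
For `I = ρ` it is the measure denoted `ρ_𝕋`. -/
def IsDisintegration [IsTopologicalAddGroup G] [LocallyCompactSpace G] [T2Space G]
    [IsTopologicalAddGroup H] [LocallyCompactSpace H] [T2Space H]
    (S : CutProjectScheme G H) (I : C_c(G × H, ℂ) → ℂ) (J : C(S.Torus, ℂ) →L[ℂ] ℂ) : Prop :=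
  ∀ g : C_c(G × H, ℂ), I g = J (S.cosetSumMap g)

end CutProjectScheme

section Weyl

variable {G H : Type*} [AddCommGroup G] [TopologicalSpace G] [AddCommGroup H] [TopologicalSpace H]

/-- The functional `g ↦ ∫ g d(m_G × m_H)` on `C_c(G × H)`. -/
noncomputable def prodFunctional [MeasurableSpace G] [MeasurableSpace H]
    (mG : Measure G) (mH : Measure H) (g : C_c(G × H, ℂ)) : ℂ :=
  ∫ t, ∫ h, g (t, h) ∂mH ∂mG

/-- The `K`-boundary `∂^K A = ((K + A) \ A°) ∪ ((-K + closure (G \ A)) ∩ A)`. -/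
def vanHoveBoundary (K A : Set G) : Set G :=
  ((K + A) \ interior A) ∪ ((-K + closure Aᶜ) ∩ A)

/-- A van Hove sequence: relatively compact Borel sets of positive measure with
`m_G(∂^K B_n) / m_G(B_n) → 0` for every compact `K`. -/
structure IsVanHove [MeasurableSpace G] (mG : Measure G) (B : ℕ → Set G) : Prop where
  measurableSet : ∀ n, MeasurableSet (B n)
  relCompact : ∀ n, IsCompact (closure (B n))
  pos : ∀ n, 0 < mG (B n)
  boundary : ∀ K : Set G, IsCompact K →
    Tendsto (fun n => mG (vanHoveBoundary K (B n)) / mG (B n)) atTop (𝓝 0)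

/-- Admissibility of `f : H → ℂ` with respect to `ρ`. -/
structure IsAdmissible [MeasurableSpace H] (ρ : ComplexRadonMeasure (G × H)) (f : H → ℂ) :
    Prop where
  measurable : Measurable f
  locallyBounded : ∀ h, ∃ U ∈ 𝓝 h, ∃ C : ℝ, ∀ x ∈ U, ‖f x‖ ≤ C
  tight : ∀ ε : ℝ, 0 < ε → ∀ φ : C_c(G, ℂ), ∃ Q : Set H, IsCompact Q ∧ ∀ (s : G) (k : H),
    @lintegral (G × H) (borel (G × H)) ρ.variation
      (fun x => ‖φ (x.1 + s) * f (x.2 + k)‖ₑ * Qᶜ.indicator 1 (x.2 + k)) ≤ ENNReal.ofReal ε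

/-- Riemann integrability of `f : H → ℝ`: sandwiched between functions in `C_c(H)` whose
integrals are arbitrarily close. -/
def IsRiemannIntegrable [MeasurableSpace H] (mH : Measure H) (f : H → ℝ) : Prop :=
  ∀ ε : ℝ, 0 < ε → ∃ φ ψ : C_c(H, ℝ), (∀ h, φ h ≤ f h ∧ f h ≤ ψ h) ∧
    ∫ h, (ψ h - φ h) ∂mH ≤ ε

/-- The integrand `(t, h) ↦ f(h + k) χ_B(t + s)` of `μ([s, k])(χ_B)`, for `x = (s, k)`. -/
noncomputable def muIntegrand (f : H → ℂ) (B : Set G) (x : G × H) : G × H → ℂ :=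
  fun y => f (y.2 + x.2) * B.indicator 1 (y.1 + x.1)

/-- For every van Hove sequence `(B_n)` the numbers
`μ([s, k])(χ_{B_n}) = ∫ f(h + k) χ_{B_n}(t + s) dρ(t, h)` exist, depend on `ξ = [s, k] ∈ 𝕋` only,
and `μ(ξ)(χ_{B_n}) / m_G(B_n)` converges to `c` uniformly in `ξ ∈ 𝕋`. -/
def WeylConvergence [MeasurableSpace G] (mG : Measure G) (S : CutProjectScheme G H)
    (ρ : ComplexRadonMeasure (G × H)) (f : H → ℂ) (c : ℂ) : Prop :=
  ∀ B : ℕ → Set G, IsVanHove mG B →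
    (∀ n x, ρ.IntegrableFun (muIntegrand f (B n) x)) ∧
    ∃ μ : ℕ → S.Torus → ℂ,
      (∀ n (x : G × H), μ n (QuotientAddGroup.mk x) = ρ.integral (muIntegrand f (B n) x)) ∧
      TendstoUniformly (fun n ξ => μ n ξ / (mG.real (B n) : ℂ)) (fun _ => c) atTop

end Weyl


/-!
A functional `J` on `C(𝕋)` is recovered from the invariant functional on `C_c(G × H)` it
disintegrates, because every `F ∈ C(𝕋)` is the coset sum of `g • (F ∘ π)`, for a fixed `g` whose
coset sums are all `1`; invariance makes the result independent of `g`.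

For `f ∈ C_c(H)` let `F n` be the coset sum of `u n ⊗ f`, where `u n` is a continuous approximation
of `χ_{B n}`. Since the lattice projects densely to `H`, any two points of `𝕋` differ by the class
of some `(c, v)` with `c` in a fixed compact set and `v` near `0`, so by the van Hove property
`F n` varies by `o(m_G(B n))`. Hence `F n = κ n + o(m_G(B n))` with a constant `κ n`, and comparing
`mT (F n) = (∫ u n) (∫ f)` with the translates of `F n` under `ρT` gives the limit. Replacing `u n`
by `χ_{B n}` only costs the `|ρ|`-mass of a strip over the boundary of `B n`, which is small because
`|ρ|` is translation bounded.

For the other two classes, `f` is approximated by `g ∈ C_c(H)` so that the mass of `f - g` over the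
strip above `B n` is at most `ε m_G(B n)` uniformly. For an admissible `f` this mass is controlled
by tightness, applied to a covering of `B n` by translates of a compact set; for a Riemann
integrable `f` it is at most that of `ψ - φ ∈ C_c(H)`, to which the first case applies.
-/

section CompactlySupported

variable {X Y E : Type*} [TopologicalSpace X] [TopologicalSpace Y]

/-- The translate `y ↦ g (y + x)` of a compactly supported continuous function. -/
def ccTranslate [AddGroup X] [ContinuousAdd X] [TopologicalSpace E] [Zero E]
    (g : C_c(X, E)) (x : X) : C_c(X, E) :=
  g.comp (Homeomorph.addRight x).toCocompactMap

@[simp]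
theorem ccTranslate_apply [AddGroup X] [ContinuousAdd X] [TopologicalSpace E] [Zero E]
    (g : C_c(X, E)) (x y : X) : ccTranslate g x y = g (y + x) := rfl

/-- A real compactly supported continuous function, regarded as a complex one. -/
noncomputable def ccOfReal (g : C_c(X, ℝ)) : C_c(X, ℂ) :=
  g.compLeft ⟨Complex.ofReal, Complex.continuous_ofReal⟩

@[simp]
theorem ccOfReal_apply (g : C_c(X, ℝ)) (y : X) : ccOfReal g y = (g y : ℂ) :=
  CompactlySupportedContinuousMap.compLeft_apply (by simp) g y

/-- The compactly supported continuous function `y ↦ ‖g y‖`. -/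
noncomputable def ccNorm [NormedAddCommGroup E] (g : C_c(X, E)) : C_c(X, ℝ) :=
  g.compLeft ⟨norm, continuous_norm⟩

@[simp]
theorem ccNorm_apply [NormedAddCommGroup E] (g : C_c(X, E)) (y : X) : ccNorm g y = ‖g y‖ :=
  CompactlySupportedContinuousMap.compLeft_apply (by simp) g y

/-- The tensor product `(t, h) ↦ φ t * f h` of compactly supported continuous functions. -/
noncomputable def ccTensor [R1Space X] [R1Space Y] (φ : C_c(X, ℂ)) (f : C_c(Y, ℂ)) :
    C_c(X × Y, ℂ) where
  toFun y := φ y.1 * f y.2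
  hasCompactSupport' := by
    refine HasCompactSupport.of_support_subset_isCompact
      (φ.hasCompactSupport.isCompact.prod f.hasCompactSupport.isCompact) fun y hy => ?_
    exact ⟨subset_tsupport _ (left_ne_zero_of_mul hy), subset_tsupport _ (right_ne_zero_of_mul hy)⟩

@[simp]
theorem ccTensor_apply [R1Space X] [R1Space Y] (φ : C_c(X, ℂ)) (f : C_c(Y, ℂ)) (y : X × Y) :
    ccTensor φ f y = φ y.1 * f y.2 := rfl

/-- `u` is a cutoff function between `K` and `U`: it takes values in `[0, 1]`, equals `1` on `K` and
vanishes outside `U`. -/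
structure IsCutoff (u : C_c(X, ℝ)) (K U : Set X) : Prop where
  eq_one : ∀ x ∈ K, u x = 1
  eq_zero : ∀ x ∉ U, u x = 0
  nonneg : ∀ x, 0 ≤ u x
  le_one : ∀ x, u x ≤ 1

theorem exists_isCutoff [RegularSpace X] [LocallyCompactSpace X] {K U : Set X} (hK : IsCompact K)
    (hU : IsOpen U) (hKU : K ⊆ U) : ∃ u : C_c(X, ℝ), IsCutoff u K U := by
  obtain ⟨f, h1, h0, hc, hI⟩ := exists_continuous_one_zero_of_isCompact hK hU.isClosed_compl
    (disjoint_compl_right_iff_subset.2 hKU)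
  exact ⟨⟨f, hc⟩, fun x hx => h1 hx, fun x hx => h0 hx, fun x => (hI x).1, fun x => (hI x).2⟩

namespace IsCutoff

variable {u : C_c(X, ℝ)} {K U : Set X}

theorem mono {K' U' : Set X} (hu : IsCutoff u K U) (hK : K' ⊆ K) (hU : U ⊆ U') :
    IsCutoff u K' U' where
  eq_one x hx := hu.eq_one x (hK hx)
  eq_zero x hx := hu.eq_zero x fun h => hx (hU h)
  nonneg := hu.nonneg
  le_one := hu.le_one

theorem indicator_le_enorm (hu : IsCutoff u K U) (x : X) : K.indicator 1 x ≤ ‖u x‖ₑ := by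
  by_cases hx : x ∈ K
  · simp [hx, hu.eq_one x hx]
  · simp [hx]

theorem enorm_le_indicator (hu : IsCutoff u K U) (x : X) : ‖u x‖ₑ ≤ U.indicator 1 x := by
  by_cases hx : x ∈ U
  · simpa [hx, Real.enorm_of_nonneg (hu.nonneg x)] using hu.le_one x
  · simp [hx, hu.eq_zero x hx]

theorem enorm_smul_sub_indicator_le {E : Type*} [NormedAddCommGroup E] [NormedSpace ℝ E]
    (hu : IsCutoff u K U) {A : Set X} (hKA : K ⊆ A) (hAU : A ⊆ U) (c : E) (x : X) :
    ‖u x • c - A.indicator (fun _ => c) x‖ₑ ≤ (U \ K).indicator (fun _ => ‖c‖ₑ) x := by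
  by_cases hxK : x ∈ K
  · simp [hu.eq_one x hxK, hKA hxK]
  by_cases hxU : x ∈ U
  · have hle : ∀ r : ℝ, |r| ≤ 1 → ‖r • c‖ₑ ≤ ‖c‖ₑ := fun r hr => by
      rw [enorm_le_iff_norm_le, norm_smul]
      exact mul_le_of_le_one_left (norm_nonneg c) hr
    rw [indicator_of_mem (show x ∈ U \ K from ⟨hxU, hxK⟩)]
    have h0 := hu.nonneg x
    have h1 := hu.le_one x
    by_cases hxA : x ∈ A
    · convert hle (u x - 1) (abs_le.2 ⟨by linarith, by linarith⟩) using 2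
      rw [indicator_of_mem hxA, sub_smul, one_smul]
    · rw [indicator_of_notMem hxA, sub_zero]
      exact hle _ (abs_le.2 ⟨by linarith, h1⟩)
  · simp [hu.eq_zero x hxU, indicator_of_notMem fun hxA => hxU (hAU hxA)]

end IsCutoff

theorem measurable_borel_of_continuous [MeasurableSpace Y] [BorelSpace Y] {f : X → Y}
    (hf : Continuous f) : Measurable[borel X] f := by
  borelize X
  exact hf.measurable

end CompactlySupported

section TopologicalGroup

variable {G : Type*} [AddCommGroup G] [TopologicalSpace G] [IsTopologicalAddGroup G]

theorem isCompact_sub {K L : Set G} (hK : IsCompact K) (hL : IsCompact L) :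
    IsCompact (K - L) :=
  sub_eq_add_neg K L ▸ hK.add hL.neg

theorem exists_symm_compact_nhds_zero [LocallyCompactSpace G] :
    ∃ K : Set G, IsCompact K ∧ K ∈ 𝓝 0 ∧ -K = K := by
  obtain ⟨K, hK, hK0⟩ := exists_compact_mem_nhds (0 : G)
  refine ⟨K ∪ -K, hK.union hK.neg, mem_of_superset hK0 subset_union_left, ?_⟩
  rw [Set.union_neg, neg_neg, union_comm]

theorem exists_isCutoff_add [LocallyCompactSpace G] {K B : Set G} (hK : K ∈ 𝓝 0)
    (hB : IsCompact (closure B)) : ∃ u : C_c(G, ℝ), IsCutoff u B (B + K) := by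
  have hsub : closure B ⊆ B + interior K := by
    rw [add_comm, ← isOpen_interior.add_closure]
    exact fun x hx => ⟨0, mem_interior_iff_mem_nhds.2 hK, x, hx, zero_add x⟩
  obtain ⟨u, hu⟩ := exists_isCutoff hB isOpen_interior.add_left hsub
  exact ⟨u, hu.mono subset_closure (add_subset_add_left interior_subset)⟩

theorem exists_nhds_zero_forall_norm_sub_le {E : Type*} [NormedAddCommGroup E] (f : C_c(G, E))
    {δ : ℝ} (hδ : 0 < δ) : ∃ V ∈ 𝓝 (0 : G), ∀ v ∈ V, ∀ h, ‖f (h + v) - f h‖ ≤ δ := by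
  let _ := IsTopologicalAddGroup.rightUniformSpace G
  have := isUniformAddGroup_of_addCommGroup (G := G)
  have hf : UniformContinuous f := f.hasCompactSupport.uniformContinuous_of_continuous f.continuous
  have hmem := hf (Metric.dist_mem_uniformity hδ)
  rw [Filter.mem_map, uniformity_eq_comap_nhds_zero, mem_comap] at hmem
  obtain ⟨V, hV, hVf⟩ := hmem
  refine ⟨V, hV, fun v hv h => ?_⟩
  have hdist : dist (f h) (f (h + v)) < δ := hVf (show (h, h + v) ∈ _ by simpa using hv)
  exact (dist_eq_norm_sub' (f h) (f (h + v)) ▸ hdist).le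

end TopologicalGroup

section Covering

theorem sub_mem_sub_of_not_disjoint_vadd {G : Type*} [AddCommGroup G] {K : Set G} {a b : G}
    (h : ¬ Disjoint (a +ᵥ K) (b +ᵥ K)) : a - b ∈ K - K := by
  obtain ⟨_, ⟨z, hz, rfl⟩, z', hz', h⟩ := Set.not_disjoint_iff.1 h
  refine ⟨z', hz', z, hz, ?_⟩
  simp only [vadd_eq_add] at h ⊢
  rw [sub_eq_sub_iff_add_eq_add, add_comm z', h, add_comm]

variable {G : Type*} [AddCommGroup G] [TopologicalSpace G] [IsTopologicalAddGroup G] [T2Space G]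
  [MeasurableSpace G] [BorelSpace G] {mG : Measure G} [mG.IsAddLeftInvariant] {K A : Set G}

theorem card_mul_measure_le_of_pairwiseDisjoint_vadd (hK : IsCompact K) {F : Finset G}
    (hFA : (F : Set G) ⊆ A) (hF : (F : Set G).PairwiseDisjoint fun a => a +ᵥ K) :
    F.card * mG K ≤ mG (A + K) :=
  calc F.card * mG K = ∑ a ∈ F, mG (a +ᵥ K) := by simp
    _ = mG (⋃ a ∈ F, a +ᵥ K) :=
      (measure_biUnion_finset hF fun a _ => (hK.vadd a).measurableSet).symm
    _ ≤ mG (A + K) := measure_mono <| iUnion₂_subset fun a ha => by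
      rintro _ ⟨z, hz, rfl⟩
      exact add_mem_add (hFA ha) hz

-- A maximal packing of translates of `K` with centres in `A` covers `A` by translates of `K - K`.
theorem exists_finset_card_mul_measure_le_subset_add_sub (hK : IsCompact K) (hK0 : mG K ≠ 0)
    (hA : mG (A + K) ≠ ⊤) :
    ∃ F : Finset G, F.card * mG K ≤ mG (A + K) ∧ A ⊆ F + (K - K) := by
  classical
  let packings : Set (Finset G) :=
    {F | (F : Set G) ⊆ A ∧ (F : Set G).PairwiseDisjoint fun a => a +ᵥ K}
  have hcard : ∀ F ∈ packings, F.card * mG K ≤ mG (A + K) := fun F hF =>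
    card_mul_measure_le_of_pairwiseDisjoint_vadd hK hF.1 hF.2
  have hbdd : BddAbove (Finset.card '' packings) := by
    obtain ⟨n, hn⟩ := ENNReal.exists_nat_gt (ENNReal.div_ne_top hA hK0)
    refine ⟨n, forall_mem_image.2 fun F hF => ?_⟩
    have h := (ENNReal.le_div_iff_mul_le (Or.inl hK0) (Or.inr hA)).2 (hcard F hF)
    exact_mod_cast h.trans hn.le
  obtain ⟨F, hF, hFmax⟩ := Nat.sSup_mem ⟨_, mem_image_of_mem _
    (show ∅ ∈ packings by simp [packings])⟩ hbdd
  refine ⟨F, hcard F hF, fun a ha => ?_⟩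
  by_contra hcon
  have hdisj : ∀ b ∈ F, Disjoint (a +ᵥ K) (b +ᵥ K) := fun b hb => by
    by_contra hne
    exact hcon ⟨b, hb, a - b, sub_mem_sub_of_not_disjoint_vadd hne, add_sub_cancel b a⟩
  have haF : a ∉ F := by
    obtain ⟨z, hz⟩ : K.Nonempty := nonempty_iff_ne_empty.2 fun h => hK0 (by simp [h])
    exact fun h => hcon ⟨a, h, 0, ⟨z, hz, z, hz, sub_self z⟩, add_zero a⟩
  have hins : insert a F ∈ packings := by
    constructor
    · rw [Finset.coe_insert]
      exact insert_subset ha hF.1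
    · rw [Finset.coe_insert]
      exact hF.2.insert fun b hb _ => hdisj b hb
  have hle := le_csSup hbdd (mem_image_of_mem _ hins)
  rw [Finset.card_insert_of_notMem haF, ← hFmax] at hle
  omega

end Covering

section VanHove

/-- The thickened boundary `(B + D) ∩ (Bᶜ + D)` of `B`: the points that a shift by `-D` can carry
both into `B` and out of `B`. -/
def thickBoundary {G : Type*} [AddCommGroup G] (D B : Set G) : Set G := (B + D) ∩ (Bᶜ + D)

theorem thickBoundary_add_subset {G : Type*} [AddCommGroup G] (D K B : Set G) :
    thickBoundary D B + K ⊆ thickBoundary (D + K) B := by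
  rintro _ ⟨a, ha, k, hk, rfl⟩
  rw [thickBoundary, ← add_assoc, ← add_assoc]
  exact ⟨add_mem_add ha.1 hk, add_mem_add ha.2 hk⟩

variable {G : Type*} [AddCommGroup G] [TopologicalSpace G]

theorem thickBoundary_subset_vanHoveBoundary {D : Set G} (hD : -D = D) (B : Set G) :
    thickBoundary D B ⊆ vanHoveBoundary D B := by
  intro z ⟨hz, hz'⟩
  by_cases hzB : z ∈ interior B
  · refine Or.inr ⟨?_, interior_subset hzB⟩
    rw [hD, add_comm]
    exact add_subset_add_right subset_closure hz'
  · exact Or.inl ⟨add_comm B D ▸ hz, hzB⟩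

theorem add_subset_union_vanHoveBoundary (B D : Set G) : B + D ⊆ B ∪ vanHoveBoundary D B := by
  intro z hz
  by_cases hzB : z ∈ B
  · exact Or.inl hzB
  · exact Or.inr (Or.inl ⟨add_comm B D ▸ hz, fun h => hzB (interior_subset h)⟩)

namespace IsVanHove

variable [MeasurableSpace G] {mG : Measure G} [IsFiniteMeasureOnCompacts mG] {B : ℕ → Set G}
  {D : Set G}

theorem measure_ne_top (hB : IsVanHove mG B) (n : ℕ) : mG (B n) ≠ ⊤ :=
  ne_top_of_le_ne_top (hB.relCompact n).measure_ne_top (measure_mono subset_closure)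

theorem measure_add_ne_top [IsTopologicalAddGroup G] (hB : IsVanHove mG B) (hD : IsCompact D)
    (n : ℕ) : mG (B n + D) ≠ ⊤ :=
  ne_top_of_le_ne_top ((hB.relCompact n).add hD).measure_ne_top
    (measure_mono (add_subset_add_right subset_closure))

theorem eventually_boundary_le (hB : IsVanHove mG B) (hD : IsCompact D) {δ : ENNReal}
    (hδ : δ ≠ 0) : ∀ᶠ n in atTop, mG (vanHoveBoundary D (B n)) ≤ δ * mG (B n) := by
  filter_upwards [(hB.boundary D hD).eventually_lt_const (pos_iff_ne_zero.2 hδ)] with n hn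
  exact (ENNReal.div_le_iff (hB.pos n).ne' (hB.measure_ne_top n)).1 hn.le

theorem eventually_add_le (hB : IsVanHove mG B) (hD : IsCompact D) {δ : ENNReal} (hδ : δ ≠ 0) :
    ∀ᶠ n in atTop, mG (B n + D) ≤ (1 + δ) * mG (B n) := by
  filter_upwards [hB.eventually_boundary_le hD hδ] with n hn
  calc mG (B n + D) ≤ mG (B n ∪ vanHoveBoundary D (B n)) :=
        measure_mono (add_subset_union_vanHoveBoundary _ _)
    _ ≤ mG (B n) + mG (vanHoveBoundary D (B n)) := measure_union_le _ _
    _ ≤ mG (B n) + δ * mG (B n) := by gcongr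
    _ = (1 + δ) * mG (B n) := by ring

end IsVanHove

end VanHove

section Strip

variable {G H : Type*} [AddCommGroup G] [TopologicalSpace G] [AddCommGroup H] [TopologicalSpace H]

/-- The integral of `(t, h) ↦ 1_A(t) q(h)` against `v`, shifted by `x`. -/
noncomputable def stripLIntegral (v : @Measure (G × H) (borel (G × H))) (A : Set G)
    (q : H → ENNReal) (x : G × H) : ENNReal :=
  ∫⁻ y, A.indicator 1 (y.1 + x.1) * q (y.2 + x.2) ∂v

variable {v : @Measure (G × H) (borel (G × H))} {A : Set G} {q : H → ENNReal}

theorem stripLIntegral_mono {A' : Set G} {q' : H → ENNReal} (hA : A ⊆ A') (hq : ∀ h, q h ≤ q' h)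
    (x : G × H) : stripLIntegral v A q x ≤ stripLIntegral v A' q' x :=
  lintegral_mono fun _ => mul_le_mul' (indicator_le_indicator_of_subset hA (fun _ => zero_le) _)
    (hq _)

theorem stripLIntegral_finset_add_le [ContinuousAdd G] [MeasurableSpace G] [BorelSpace G]
    [ContinuousAdd H] [MeasurableSpace H] [BorelSpace H] (F : Finset G) (hA : MeasurableSet A)
    (hq : Measurable q) {M : ENNReal} (hM : ∀ x, stripLIntegral v A q x ≤ M) (x : G × H) :
    stripLIntegral v (F + A) q x ≤ F.card * M := by
  have hpt : ∀ y : G × H, ((F : Set G) + A).indicator 1 (y.1 + x.1) * q (y.2 + x.2) ≤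
      ∑ b ∈ F, A.indicator 1 (y.1 + (x.1 - b)) * q (y.2 + x.2) := fun y => by
    by_cases hy : y.1 + x.1 ∈ (F : Set G) + A
    · obtain ⟨b, hb, a, ha, hba⟩ := hy
      have hya : y.1 + (x.1 - b) ∈ A := by
        rwa [← add_sub_assoc, ← hba, add_sub_cancel_left]
      refine le_trans ?_ (Finset.single_le_sum (fun _ _ => zero_le) hb)
      simpa [hya] using mul_le_of_le_one_left zero_le
        (indicator_le_self' (s := (F : Set G) + A) (f := (1 : G → ENNReal))
          (fun _ _ => zero_le) (y.1 + x.1))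
    · simp [hy]
  have hmeas : ∀ b ∈ F, @Measurable _ _ (borel (G × H)) _
      fun y : G × H => A.indicator (1 : G → ENNReal) (y.1 + (x.1 - b)) * q (y.2 + x.2) :=
    fun b _ => ((measurable_one.indicator hA).comp
      (measurable_borel_of_continuous (by fun_prop))).mul
      (hq.comp (measurable_borel_of_continuous (by fun_prop)))
  calc stripLIntegral v (F + A) q x
      ≤ ∑ b ∈ F, stripLIntegral v A q (x.1 - b, x.2) :=
        (lintegral_mono hpt).trans_eq (lintegral_finsetSum F hmeas)
    _ ≤ F.card • M := Finset.sum_le_card_nsmul _ _ M fun b _ => hM _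
    _ = F.card * M := nsmul_eq_mul _ _

/-- `v` is translation bounded: the integrals of the translates of any fixed compactly supported
continuous function are bounded. -/
def TranslationBounded {X : Type*} [TopologicalSpace X] [Add X] (v : @Measure X (borel X)) : Prop :=
  ∀ g : C_c(X, ℂ), ∃ M ≠ (⊤ : ENNReal), ∀ x, ∫⁻ y, ‖g (y + x)‖ₑ ∂v ≤ M

variable [IsTopologicalAddGroup G]

theorem TranslationBounded.exists_stripLIntegral_isCompact_le
    [LocallyCompactSpace G] [IsTopologicalAddGroup H] [LocallyCompactSpace H]
    {K : Set G} {Q : Set H} (hv : TranslationBounded v) (hK : IsCompact K) (hQ : IsCompact Q) :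
    ∃ M ≠ (⊤ : ENNReal), ∀ x, stripLIntegral v K (Q.indicator 1) x ≤ M := by
  obtain ⟨φ, hφ⟩ := exists_isCutoff hK isOpen_univ (subset_univ _)
  obtain ⟨θ, hθ⟩ := exists_isCutoff hQ isOpen_univ (subset_univ _)
  obtain ⟨M, hMtop, hM⟩ := hv (ccTensor (ccOfReal φ) (ccOfReal θ))
  refine ⟨M, hMtop, fun x => (lintegral_mono fun y => ?_).trans (hM x)⟩
  simpa [enorm_mul, ← ofReal_norm] using
    mul_le_mul' (hφ.indicator_le_enorm (y.1 + x.1)) (hθ.indicator_le_enorm (y.2 + x.2))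

variable [T2Space G] [MeasurableSpace G] [BorelSpace G]
  [MeasurableSpace H] [BorelSpace H] {mG : Measure G}

theorem stripLIntegral_mul_le [mG.IsAddLeftInvariant] [ContinuousAdd H] {K : Set G}
    (hK : IsCompact K) (hK0 : mG K ≠ 0) (hq : Measurable q) {M : ENNReal}
    (hM : ∀ x, stripLIntegral v (K - K) q x ≤ M) (hA : mG (A + K) ≠ ⊤) (x : G × H) :
    stripLIntegral v A q x * mG K ≤ M * mG (A + K) := by
  obtain ⟨F, hF, hAF⟩ := exists_finset_card_mul_measure_le_subset_add_sub hK hK0 hA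
  have hKK : MeasurableSet (K - K) := (isCompact_sub hK hK).measurableSet
  calc stripLIntegral v A q x * mG K
      ≤ F.card * M * mG K := by
        gcongr
        exact (stripLIntegral_mono hAF (fun _ => le_rfl) x).trans
          (stripLIntegral_finset_add_le F hKK hq hM x)
    _ = M * (F.card * mG K) := by ring
    _ ≤ M * mG (A + K) := by gcongr

namespace TranslationBounded

variable [LocallyCompactSpace G] [mG.IsAddHaarMeasure] [IsTopologicalAddGroup H]
  [LocallyCompactSpace H] [T2Space H] {Q : Set H} {D : Set G} {B : ℕ → Set G}

theorem exists_stripLIntegral_le (hv : TranslationBounded v) {K : Set G} (hK : IsCompact K)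
    (hK0 : K ∈ 𝓝 0) (hQ : IsCompact Q) :
    ∃ M ≠ (⊤ : ENNReal), ∀ A : Set G, mG (A + K) ≠ ⊤ → ∀ x,
      stripLIntegral v A (Q.indicator 1) x ≤ M * mG (A + K) := by
  obtain ⟨M, hMtop, hM⟩ := hv.exists_stripLIntegral_isCompact_le (isCompact_sub hK hK) hQ
  have hmK : mG K ≠ 0 := (Measure.measure_pos_of_mem_nhds mG hK0).ne'
  refine ⟨M / mG K, ENNReal.div_ne_top hMtop hmK, fun A hA x => ?_⟩
  rw [← ENNReal.mul_div_right_comm, ENNReal.le_div_iff_mul_le (Or.inl hmK)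
    (Or.inl hK.measure_ne_top)]
  exact stripLIntegral_mul_le hK hmK (measurable_one.indicator hQ.measurableSet) hM hA x

theorem eventually_stripLIntegral_thickBoundary_le (hv : TranslationBounded v)
    (hB : IsVanHove mG B) (hD : IsCompact D) (hDs : -D = D) (hQ : IsCompact Q) {δ : ENNReal}
    (hδ : δ ≠ 0) : ∀ᶠ n in atTop, ∀ x,
      stripLIntegral v (thickBoundary D (B n)) (Q.indicator 1) x ≤ δ * mG (B n) := by
  obtain ⟨K, hK, hK0, hKs⟩ := exists_symm_compact_nhds_zero (G := G)
  obtain ⟨M, hMtop, hM⟩ := hv.exists_stripLIntegral_le (mG := mG) hK hK0 hQ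
  filter_upwards [hB.eventually_boundary_le (hD.add hK) (ENNReal.div_pos hδ hMtop).ne'] with n hn x
  have hsub : thickBoundary D (B n) + K ⊆ thickBoundary (D + K) (B n) :=
    thickBoundary_add_subset D K (B n)
  have hbdry : thickBoundary (D + K) (B n) ⊆ vanHoveBoundary (D + K) (B n) :=
    thickBoundary_subset_vanHoveBoundary (by rw [neg_add, hDs, hKs]) (B n)
  have hfin : mG (thickBoundary D (B n) + K) ≠ ⊤ :=
    ne_top_of_le_ne_top (hB.measure_add_ne_top (hD.add hK) n)
      (measure_mono (hsub.trans inter_subset_left))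
  calc stripLIntegral v (thickBoundary D (B n)) (Q.indicator 1) x
      ≤ M * mG (thickBoundary D (B n) + K) := hM _ hfin x
    _ ≤ M * (δ / M * mG (B n)) := by gcongr; exact (measure_mono (hsub.trans hbdry)).trans hn
    _ = M * (δ / M) * mG (B n) := by ring
    _ ≤ δ * mG (B n) := by gcongr; exact ENNReal.mul_div_le

theorem exists_eventually_stripLIntegral_le (hv : TranslationBounded v) (hB : IsVanHove mG B)
    (hD : IsCompact D) (hQ : IsCompact Q) : ∃ M ≠ (⊤ : ENNReal), ∀ᶠ n in atTop, ∀ x,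
      stripLIntegral v (B n + D) (Q.indicator 1) x ≤ M * mG (B n) := by
  obtain ⟨K, hK, hK0, -⟩ := exists_symm_compact_nhds_zero (G := G)
  obtain ⟨M, hMtop, hM⟩ := hv.exists_stripLIntegral_le (mG := mG) hK hK0 hQ
  refine ⟨M * 2, ENNReal.mul_ne_top hMtop ENNReal.ofNat_ne_top, ?_⟩
  filter_upwards [hB.eventually_add_le (hD.add hK) one_ne_zero] with n hn x
  rw [← add_assoc, one_add_one_eq_two] at hn
  have hfin : mG (B n + D + K) ≠ ⊤ := add_assoc (B n) D K ▸ hB.measure_add_ne_top (hD.add hK) n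
  calc stripLIntegral v (B n + D) (Q.indicator 1) x ≤ M * mG (B n + D + K) := hM _ hfin x
    _ ≤ M * (2 * mG (B n)) := by gcongr
    _ = M * 2 * mG (B n) := (mul_assoc _ _ _).symm

end TranslationBounded

end Strip

section IteratedIntegral

variable {G H E : Type*} [TopologicalSpace G] [TopologicalSpace H] [NormedAddCommGroup E]
  [MeasurableSpace H] [BorelSpace H]

theorem integrable_slice [T2Space H] (mH : Measure H) [IsFiniteMeasureOnCompacts mH] {g : G × H → E}
    (hg : Continuous g) (hc : HasCompactSupport g) (t : G) : Integrable (fun h => g (t, h)) mH := by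
  refine (hg.comp (by fun_prop : Continuous fun h => (t, h))).integrable_of_hasCompactSupport ?_
  refine HasCompactSupport.of_support_subset_isCompact (hc.isCompact.image continuous_snd) ?_
  exact fun h hh => ⟨(t, h), subset_tsupport _ hh, rfl⟩

variable [NormedSpace ℝ E]

theorem continuous_integral_slice (mH : Measure H) [IsFiniteMeasureOnCompacts mH] {g : G × H → E}
    (hg : Continuous g) (hc : HasCompactSupport g) : Continuous fun t => ∫ h, g (t, h) ∂mH := by
  rw [← continuousOn_univ]
  refine continuousOn_integral_of_compact_support (f := fun t h => g (t, h))
    (hc.isCompact.image continuous_snd) hg.continuousOn fun t h _ hh => ?_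
  by_contra hne
  exact hh ⟨(t, h), subset_tsupport _ hne, rfl⟩

theorem hasCompactSupport_integral_slice {G H E : Type*} [TopologicalSpace G]
    [TopologicalSpace H] [T2Space G] [NormedAddCommGroup E] [NormedSpace ℝ E] [MeasurableSpace H]
    (mH : Measure H) {g : G × H → E} (hc : HasCompactSupport g) :
    HasCompactSupport fun t => ∫ h, g (t, h) ∂mH := by
  refine HasCompactSupport.of_support_subset_isCompact (hc.isCompact.image continuous_fst) ?_
  intro t ht
  by_contra hne
  refine ht (integral_eq_zero_of_ae (ae_of_all _ fun h => ?_))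
  by_contra hh
  exact hne ⟨(t, h), subset_tsupport _ hh, rfl⟩

variable [T2Space G] [MeasurableSpace G] [BorelSpace G]

theorem integrable_integral_slice (mG : Measure G) [IsFiniteMeasureOnCompacts mG] (mH : Measure H)
    [IsFiniteMeasureOnCompacts mH] {g : G × H → E}
    (hg : Continuous g) (hc : HasCompactSupport g) :
    Integrable (fun t => ∫ h, g (t, h) ∂mH) mG :=
  (continuous_integral_slice mH hg hc).integrable_of_hasCompactSupport
    (hasCompactSupport_integral_slice mH hc)

variable [T2Space H]

theorem integral_integral_comp_comm {F : Type*} [NormedAddCommGroup F] [NormedSpace ℝ F]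
    [NormedSpace ℂ E] [NormedSpace ℂ F] [CompleteSpace E] [CompleteSpace F]
    (mG : Measure G) [IsFiniteMeasureOnCompacts mG] (mH : Measure H)
    [IsFiniteMeasureOnCompacts mH] {g : G × H → E}
    (hg : Continuous g) (hc : HasCompactSupport g) (J : E →L[ℂ] F) :
    ∫ t, ∫ h, J (g (t, h)) ∂mH ∂mG = J (∫ t, ∫ h, g (t, h) ∂mH ∂mG) := by
  rw [← J.integral_comp_comm (integrable_integral_slice mG mH hg hc)]
  congr 1 with t
  exact J.integral_comp_comm (integrable_slice mH hg hc t)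

theorem norm_integral_integral_le (mG : Measure G) [IsFiniteMeasureOnCompacts mG] (mH : Measure H)
    [IsFiniteMeasureOnCompacts mH] {g : G × H → E} {w : G × H → ℝ} (hw : Continuous w)
    (hwc : HasCompactSupport w) (hgw : ∀ y, ‖g y‖ ≤ w y) :
    ‖∫ t, ∫ h, g (t, h) ∂mH ∂mG‖ ≤ ∫ t, ∫ h, w (t, h) ∂mH ∂mG :=
  norm_integral_le_of_norm_le (integrable_integral_slice mG mH hw hwc) <| ae_of_all _ fun t =>
    norm_integral_le_of_norm_le (integrable_slice mH hw hwc t) <| ae_of_all _ fun h => hgw (t, h)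

end IteratedIntegral

section ProdFunctional

variable {G H : Type*} [TopologicalSpace G] [TopologicalSpace H] [MeasurableSpace G]
  [MeasurableSpace H]

theorem prodFunctional_ccTensor [R1Space G] [R1Space H] (mG : Measure G) (mH : Measure H)
    (φ : C_c(G, ℂ)) (f : C_c(H, ℂ)) :
    prodFunctional mG mH (ccTensor φ f) = (∫ t, φ t ∂mG) * ∫ h, f h ∂mH := by
  simp_rw [prodFunctional, ccTensor_apply, integral_const_mul, integral_mul_const]

theorem prodFunctional_ccTranslate [AddGroup G] [ContinuousAdd G] [BorelSpace G] [AddGroup H]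
    [ContinuousAdd H] [BorelSpace H] (mG : Measure G) [mG.IsAddRightInvariant] (mH : Measure H)
    [mH.IsAddRightInvariant] (g : C_c(G × H, ℂ)) (x : G × H) :
    prodFunctional mG mH (ccTranslate g x) = prodFunctional mG mH g := by
  simp only [prodFunctional, ccTranslate_apply]
  have hslice : ∀ t, ∫ h, g ((t, h) + x) ∂mH = ∫ h, g (t + x.1, h) ∂mH := fun t =>
    integral_add_right_eq_self (μ := mH) (fun h => g (t + x.1, h)) x.2
  simp_rw [hslice]
  exact integral_add_right_eq_self (μ := mG) (fun t => ∫ h, g (t, h) ∂mH) x.1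

variable [T2Space G] [T2Space H] [BorelSpace G] [BorelSpace H]
  (mG : Measure G) [IsFiniteMeasureOnCompacts mG] (mH : Measure H) [IsFiniteMeasureOnCompacts mH]

/-- `prodFunctional` as a linear map. -/
noncomputable def prodLinearMap : C_c(G × H, ℂ) →ₗ[ℂ] ℂ where
  toFun := prodFunctional mG mH
  map_add' f g := by
    simp only [prodFunctional, CompactlySupportedContinuousMap.add_apply]
    rw [← integral_add (integrable_integral_slice mG mH (map_continuous f) f.hasCompactSupport)
      (integrable_integral_slice mG mH (map_continuous g) g.hasCompactSupport)]
    congr 1 with t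
    exact integral_add (integrable_slice mH (map_continuous f) f.hasCompactSupport t)
      (integrable_slice mH (map_continuous g) g.hasCompactSupport t)
  map_smul' c f := by
    simp only [prodFunctional, CompactlySupportedContinuousMap.smul_apply, integral_smul,
      RingHom.id_apply]

theorem exists_norm_prodFunctional_smul_le (w : C_c(G × H, ℂ)) :
    ∃ C : ℝ, ∀ (F : C(G × H, ℂ)) (a : ℝ), (∀ x, ‖F x‖ ≤ a) →
      ‖prodFunctional mG mH (F • w)‖ ≤ C * a := by
  refine ⟨∫ t, ∫ h, ‖w (t, h)‖ ∂mH ∂mG, fun F a ha => ?_⟩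
  have hbound : ∀ y, ‖(F • w) y‖ ≤ ‖w y‖ * a := fun y => by
    rw [CompactlySupportedContinuousMap.smulc_apply, norm_smul, mul_comm]
    gcongr
    exact ha y
  calc ‖prodFunctional mG mH (F • w)‖ ≤ ∫ t, ∫ h, ‖w (t, h)‖ * a ∂mH ∂mG :=
        norm_integral_integral_le mG mH (w := fun y => ‖w y‖ * a) (by fun_prop)
          w.hasCompactSupport.norm.mul_right hbound
    _ = (∫ t, ∫ h, ‖w (t, h)‖ ∂mH ∂mG) * a := by simp_rw [integral_mul_const]

theorem prodFunctional_ccOfReal_ne_zero [mG.IsOpenPosMeasure] [mH.IsOpenPosMeasure]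
    (w : C_c(G × H, ℝ)) (hw : ∀ y, 0 ≤ w y) {y : G × H} (hy : w y ≠ 0) :
    prodFunctional mG mH (ccOfReal w) ≠ 0 := by
  have hreal : prodFunctional mG mH (ccOfReal w) = ((∫ t, ∫ h, w (t, h) ∂mH ∂mG : ℝ) : ℂ) := by
    simp only [prodFunctional, ccOfReal_apply, integral_complex_ofReal]
  have hsupp : HasCompactSupport fun h => w (y.1, h) :=
    HasCompactSupport.of_support_subset_isCompact
      (w.hasCompactSupport.isCompact.image continuous_snd)
      fun h hh => ⟨(y.1, h), subset_tsupport _ hh, rfl⟩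
  have hslice : 0 < ∫ h, w (y.1, h) ∂mH :=
    Continuous.integral_pos_of_hasCompactSupport_nonneg_nonzero (x := y.2)
      (by fun_prop) hsupp (fun h => hw _) hy
  rw [hreal]
  refine Complex.ofReal_ne_zero.2 (ne_of_gt ?_)
  exact Continuous.integral_pos_of_hasCompactSupport_nonneg_nonzero (x := y.1)
    (continuous_integral_slice mH (map_continuous w) w.hasCompactSupport)
    (hasCompactSupport_integral_slice mH w.hasCompactSupport)
    (fun t => integral_nonneg fun h => hw _) hslice.ne'

end ProdFunctional

namespace CutProjectScheme

variable {G H : Type*} [AddCommGroup G] [TopologicalSpace G] [AddCommGroup H] [TopologicalSpace H]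

instance compactSpace_torus (S : CutProjectScheme G H) : CompactSpace ((G × H) ⧸ S.lattice) :=
  S.cocompact

/-- The function `F ∘ π` on `G × H`, where `π` is the quotient map onto the torus. -/
noncomputable def lift (S : CutProjectScheme G H) (F : C(S.Torus, ℂ)) : C(G × H, ℂ) :=
  ⟨fun x => F (QuotientAddGroup.mk x), F.continuous.comp QuotientAddGroup.continuous_mk⟩

@[simp]
theorem lift_apply (S : CutProjectScheme G H) (F : C(S.Torus, ℂ)) (x : G × H) :
    S.lift F x = F (QuotientAddGroup.mk x) := rfl

variable [IsTopologicalAddGroup G] [IsTopologicalAddGroup H]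

theorem exists_isCompact_forall_exists_mem_mk_eq [LocallyCompactSpace G]
    (S : CutProjectScheme G H) {V : Set H} (hV : V ∈ 𝓝 0) :
    ∃ C : Set G, IsCompact C ∧ ∀ ξ : S.Torus, ∃ c ∈ C, ∃ v ∈ V, QuotientAddGroup.mk (c, v) = ξ := by
  choose K hK hxK using fun a : G => exists_compact_mem_nhds a
  have h0V : (0 : H) ∈ interior V := mem_interior_iff_mem_nhds.2 hV
  obtain ⟨T, hT⟩ := isCompact_univ.elim_finite_subcover
    (fun a : G => (QuotientAddGroup.mk : G × H → S.Torus) '' (interior (K a) ×ˢ interior V))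
    (fun a => QuotientAddGroup.isOpenMap_coe _ (isOpen_interior.prod isOpen_interior)) (by
      intro ξ _
      obtain ⟨⟨s, k⟩, rfl⟩ := QuotientAddGroup.mk_surjective ξ
      have hopen : IsOpen {h : H | k - h ∈ interior V} :=
        isOpen_interior.preimage (continuous_const.sub continuous_id)
      obtain ⟨_, ⟨l, hlL, rfl⟩, hl⟩ := S.dense_snd.exists_mem_open hopen ⟨k, by simpa using h0V⟩
      refine mem_iUnion.2 ⟨s - l.1, (s, k) - l,
        ⟨mem_interior_iff_mem_nhds.2 (hxK _), hl⟩, ?_⟩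
      exact QuotientAddGroup.eq.2 (by simpa using hlL))
  refine ⟨⋃ a ∈ T, K a, T.isCompact_biUnion fun a _ => hK a, fun ξ => ?_⟩
  obtain ⟨a, ha, ⟨c, v⟩, ⟨hc, hv⟩, rfl⟩ := mem_iUnion₂.1 (hT (mem_univ ξ))
  exact ⟨c, mem_iUnion₂.2 ⟨a, ha, interior_subset hc⟩, v, interior_subset hv, rfl⟩

theorem exists_compact_forall_mk_eq [LocallyCompactSpace G] [LocallyCompactSpace H]
    (S : CutProjectScheme G H) :
    ∃ C : Set (G × H), IsCompact C ∧ ∀ ξ : S.Torus, ∃ y ∈ C, QuotientAddGroup.mk y = ξ := by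
  obtain ⟨V, hV, hV0⟩ := exists_compact_mem_nhds (0 : H)
  obtain ⟨C, hC, hCV⟩ := S.exists_isCompact_forall_exists_mem_mk_eq hV0
  refine ⟨C ×ˢ V, hC.prod hV, fun ξ => ?_⟩
  obtain ⟨c, hc, v, hv, hξ⟩ := hCV ξ
  exact ⟨(c, v), ⟨hc, hv⟩, hξ⟩

/-- The translates of `F`: `shift F ξ η = F (η + ξ)`. -/
noncomputable def shift (S : CutProjectScheme G H) (F : C(S.Torus, ℂ)) :
    C(S.Torus, C(S.Torus, ℂ)) :=
  ContinuousMap.curry ⟨fun p : S.Torus × S.Torus => F (p.2 + p.1),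
    F.continuous.comp (continuous_snd.add continuous_fst)⟩

@[simp]
theorem shift_apply (S : CutProjectScheme G H) (F : C(S.Torus, ℂ)) (ξ η : S.Torus) :
    S.shift F ξ η = F (η + ξ) := rfl

section Lattice

variable [T2Space G] [T2Space H] (S : CutProjectScheme G H)

theorem finite_lattice_mem {K : Set (G × H)} (hK : IsCompact K) :
    {l : S.lattice | (l : G × H) ∈ K}.Finite := by
  have := S.discrete
  have hcofin := AddSubgroup.tendsto_coe_cofinite_of_discrete S.lattice ⟨S.discrete⟩
    hK.compl_mem_cocompact
  rw [mem_map, mem_cofinite] at hcofin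
  exact hcofin.subset fun l hl => by simpa using hl

theorem summable_lattice {E : Type*} [NormedAddCommGroup E] (g : C_c(G × H, E)) (x : G × H) :
    Summable fun l : S.lattice => g (x + l) := by
  refine summable_of_hasFiniteSupport ((S.finite_lattice_mem
    (g.hasCompactSupport.isCompact.add (isCompact_singleton (x := -x)))).subset fun l hl => ?_)
  exact ⟨x + l, subset_tsupport _ hl, -x, rfl, by simp⟩

theorem exists_finset_forall_notMem_eq_zero {E : Type*} [NormedAddCommGroup E]
    (f g : C_c(G × H, E)) :
    ∃ T : Finset S.lattice, ∀ l ∉ T, ∀ x, g x ≠ 0 → f (x + l) = 0 := by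
  have hT := S.finite_lattice_mem (isCompact_sub f.hasCompactSupport.isCompact
    g.hasCompactSupport.isCompact)
  refine ⟨hT.toFinset, fun l hl x hx => ?_⟩
  by_contra hne
  exact hl (hT.mem_toFinset.2
    ⟨x + l, subset_tsupport _ hne, x, subset_tsupport _ hx, add_sub_cancel_left x _⟩)

end Lattice

variable [LocallyCompactSpace G] [T2Space G] [LocallyCompactSpace H] [T2Space H]

@[simp]
theorem cosetSumMap_apply_mk (S : CutProjectScheme G H) (g : C_c(G × H, ℂ)) (x : G × H) :
    S.cosetSumMap g (QuotientAddGroup.mk x) = ∑' l : S.lattice, g (x + l) :=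
  S.cosetSum_mk g x

section Weight

variable (S : CutProjectScheme G H)

theorem cosetSumMap_ccOfReal_mk (g : C_c(G × H, ℝ)) (x : G × H) :
    S.cosetSumMap (ccOfReal g) (QuotientAddGroup.mk x) =
      ((∑' l : S.lattice, g (x + l) : ℝ) : ℂ) := by
  simp [Complex.ofReal_tsum]

theorem cosetSumMap_lift_smul (F : C(S.Torus, ℂ)) (g : C_c(G × H, ℂ)) :
    S.cosetSumMap (S.lift F • g) = F * S.cosetSumMap g := by
  ext ξ
  obtain ⟨x, rfl⟩ := QuotientAddGroup.mk_surjective ξ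
  have hterm : ∀ l : S.lattice,
      (S.lift F • g) (x + l) = F (QuotientAddGroup.mk x) * g (x + l) := fun l => by
    simp [CompactlySupportedContinuousMap.smulc_apply]
  rw [ContinuousMap.mul_apply, cosetSumMap_apply_mk, cosetSumMap_apply_mk, ← tsum_mul_left]
  exact tsum_congr hterm

theorem cosetSumMap_ccTranslate (g : C_c(G × H, ℂ)) (x : G × H) :
    S.cosetSumMap (ccTranslate g x) = S.shift (S.cosetSumMap g) (QuotientAddGroup.mk x) := by
  ext ξ
  obtain ⟨y, rfl⟩ := QuotientAddGroup.mk_surjective ξ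
  rw [shift_apply, ← QuotientAddGroup.mk_add, cosetSumMap_apply_mk, cosetSumMap_apply_mk]
  exact tsum_congr fun l => by rw [ccTranslate_apply, add_right_comm]

theorem exists_nonneg_forall_tsum_pos :
    ∃ W : C_c(G × H, ℝ), (∀ y, 0 ≤ W y) ∧ ∀ x, 0 < ∑' l : S.lattice, W (x + l) := by
  obtain ⟨C, hC, hCmk⟩ := S.exists_compact_forall_mk_eq
  obtain ⟨W, hW⟩ := exists_isCutoff hC isOpen_univ (subset_univ C)
  refine ⟨W, hW.nonneg, fun x => ?_⟩
  obtain ⟨y, hy, hyx⟩ := hCmk (QuotientAddGroup.mk x)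
  have hl : -x + y ∈ S.lattice := QuotientAddGroup.eq.1 hyx.symm
  refine (S.summable_lattice W x).tsum_pos (fun l => hW.nonneg _) ⟨-x + y, hl⟩ ?_
  simp [hW.eq_one y hy]

theorem exists_cosetSumMap_ccOfReal_eq_one :
    ∃ w : C_c(G × H, ℝ), (∀ y, 0 ≤ w y) ∧ S.cosetSumMap (ccOfReal w) = 1 := by
  obtain ⟨W, hW0, hWpos⟩ := S.exists_nonneg_forall_tsum_pos
  have hre : ∀ x : G × H, (S.cosetSumMap (ccOfReal W) (QuotientAddGroup.mk x)).re =
      ∑' l : S.lattice, W (x + l) := fun x => by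
    rw [cosetSumMap_ccOfReal_mk, Complex.ofReal_re]
  have hre_ne : ∀ ξ : S.Torus, (S.cosetSumMap (ccOfReal W) ξ).re ≠ 0 := fun ξ => by
    obtain ⟨x, rfl⟩ := QuotientAddGroup.mk_surjective ξ
    exact hre x ▸ (hWpos x).ne'
  let R : C(S.Torus, ℝ) := ⟨fun ξ => (S.cosetSumMap (ccOfReal W) ξ).re⁻¹,
    (Complex.continuous_re.comp (map_continuous _)).inv₀ hre_ne⟩
  let w : C_c(G × H, ℝ) := R.comp ⟨QuotientAddGroup.mk, QuotientAddGroup.continuous_mk⟩ • W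
  have hw : ccOfReal w =
      S.lift ((⟨Complex.ofReal, Complex.continuous_ofReal⟩ : C(ℝ, ℂ)).comp R) • ccOfReal W := by
    ext x
    simp [w, CompactlySupportedContinuousMap.smulc_apply]
  refine ⟨w, fun y => mul_nonneg ?_ (hW0 y), ?_⟩
  · exact inv_nonneg.2 (hre y ▸ (hWpos y).le)
  · rw [hw, cosetSumMap_lift_smul]
    ext ξ
    obtain ⟨x, rfl⟩ := QuotientAddGroup.mk_surjective ξ
    rw [ContinuousMap.mul_apply, cosetSumMap_ccOfReal_mk, ← hre, ContinuousMap.comp_apply,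
      ContinuousMap.coe_mk, ContinuousMap.coe_mk, ← Complex.ofReal_mul, inv_mul_cancel₀ (hre_ne _)]
    simp

end Weight

section Unfolding

variable (S : CutProjectScheme G H)

theorem lift_cosetSumMap_smul_eq_sum {f g : C_c(G × H, ℂ)} {T : Finset S.lattice}
    (hT : ∀ l ∉ T, ∀ x, g x ≠ 0 → f (x + l) = 0) :
    S.lift (S.cosetSumMap f) • g = ∑ l ∈ T, ccTranslate f (l : G × H) * g := by
  ext x
  rw [CompactlySupportedContinuousMap.sum_apply, CompactlySupportedContinuousMap.smulc_apply,
    lift_apply, cosetSumMap_apply_mk, smul_eq_mul]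
  simp only [CompactlySupportedContinuousMap.mul_apply, ccTranslate_apply]
  by_cases hx : g x = 0
  · simp [hx]
  · rw [← Finset.sum_mul, tsum_eq_sum fun l hl => hT l hl x hx]

variable (I : C_c(G × H, ℂ) →ₗ[ℂ] ℂ) (hI : ∀ l ∈ S.lattice, ∀ g, I (ccTranslate g l) = I g)

include hI

theorem apply_lift_cosetSumMap_smul_comm (f g : C_c(G × H, ℂ)) :
    I (S.lift (S.cosetSumMap f) • g) = I (S.lift (S.cosetSumMap g) • f) := by
  classical
  obtain ⟨T, hT⟩ := S.exists_finset_forall_notMem_eq_zero f g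
  have hTneg : ∀ l ∉ -T, ∀ x, f x ≠ 0 → g (x + l) = 0 := fun l hl x hx => by
    by_contra hne
    refine hx ?_
    simpa using hT (-l) (by simpa using hl) (x + l) hne
  rw [S.lift_cosetSumMap_smul_eq_sum hT, S.lift_cosetSumMap_smul_eq_sum hTneg,
    Finset.sum_neg_index, map_sum, map_sum]
  refine Finset.sum_congr rfl fun l _ => ?_
  have htranslate : ccTranslate f (l : G × H) * g =
      ccTranslate (ccTranslate g ((-l : S.lattice) : G × H) * f) l := by
    ext x
    simp [mul_comm]
  rw [htranslate, hI l l.2]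

theorem apply_lift_cosetSumMap_smul {w : C_c(G × H, ℂ)} (hw : S.cosetSumMap w = 1)
    (g : C_c(G × H, ℂ)) : I (S.lift (S.cosetSumMap g) • w) = I g := by
  rw [S.apply_lift_cosetSumMap_smul_comm I hI, hw]
  congr 1
  ext x
  simp [CompactlySupportedContinuousMap.smulc_apply]

theorem exists_isDisintegration (hbound : ∀ w : C_c(G × H, ℂ), ∃ C : ℝ, ∀ (F : C(G × H, ℂ))
      (a : ℝ), (∀ x, ‖F x‖ ≤ a) → ‖I (F • w)‖ ≤ C * a) :
    ∃ J : C(S.Torus, ℂ) →L[ℂ] ℂ, S.IsDisintegration I J := by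
  obtain ⟨w, -, hw⟩ := S.exists_cosetSumMap_ccOfReal_eq_one
  obtain ⟨C, hC⟩ := hbound (ccOfReal w)
  let J : C(S.Torus, ℂ) →ₗ[ℂ] ℂ :=
    { toFun := fun F => I (S.lift F • ccOfReal w)
      map_add' := fun F F' => by
        rw [← map_add]
        congr 1
        ext x
        simp [CompactlySupportedContinuousMap.smulc_apply, add_mul]
      map_smul' := fun c F => by
        rw [RingHom.id_apply, ← map_smul]
        congr 1
        ext x
        simp [CompactlySupportedContinuousMap.smulc_apply, mul_assoc] }
  exact ⟨J.mkContinuous C fun F => hC (S.lift F) ‖F‖ fun x => F.norm_coe_le_norm _,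
    fun g => (S.apply_lift_cosetSumMap_smul I hI hw g).symm⟩

end Unfolding

namespace IsDisintegration

variable {S : CutProjectScheme G H} {I : C_c(G × H, ℂ) → ℂ} {J : C(S.Torus, ℂ) →L[ℂ] ℂ}

theorem apply_eq (hJ : S.IsDisintegration I J) {w : C_c(G × H, ℂ)} (hw : S.cosetSumMap w = 1)
    (F : C(S.Torus, ℂ)) : J F = I (S.lift F • w) := by
  rw [hJ, cosetSumMap_lift_smul, hw, mul_one]

theorem apply_one (hJ : S.IsDisintegration I J) {w : C_c(G × H, ℂ)} (hw : S.cosetSumMap w = 1) :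
    J 1 = I w := by
  rw [hJ, hw]

theorem unique {J' : C(S.Torus, ℂ) →L[ℂ] ℂ} (hJ : S.IsDisintegration I J)
    (hJ' : S.IsDisintegration I J') : J = J' := by
  obtain ⟨w, -, hw⟩ := S.exists_cosetSumMap_ccOfReal_eq_one
  ext F
  rw [hJ.apply_eq hw, hJ'.apply_eq hw]

theorem apply_shift (hJ : S.IsDisintegration I J) (hI : ∀ x g, I (ccTranslate g x) = I g)
    (F : C(S.Torus, ℂ)) (ξ : S.Torus) : J (S.shift F ξ) = J F := by
  obtain ⟨w, -, hw⟩ := S.exists_cosetSumMap_ccOfReal_eq_one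
  obtain ⟨x, rfl⟩ := QuotientAddGroup.mk_surjective ξ
  have hF : S.cosetSumMap (S.lift F • ccOfReal w) = F := by
    rw [cosetSumMap_lift_smul, hw, mul_one]
  rw [← hF, ← cosetSumMap_ccTranslate, ← hJ, ← hJ, hI]

end IsDisintegration

section Haar

variable [MeasurableSpace G] [BorelSpace G] [MeasurableSpace H] [BorelSpace H]
  {mG : Measure G} [mG.IsAddHaarMeasure] {mH : Measure H} [mH.IsAddHaarMeasure]
  {S : CutProjectScheme G H} {mT : C(S.Torus, ℂ) →L[ℂ] ℂ}

theorem existsUnique_isDisintegration_prodFunctional (S : CutProjectScheme G H) (mG : Measure G)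
    [mG.IsAddHaarMeasure] (mH : Measure H) [mH.IsAddHaarMeasure] :
    ∃! mT : C(S.Torus, ℂ) →L[ℂ] ℂ, S.IsDisintegration (prodFunctional mG mH) mT := by
  obtain ⟨mT, hmT⟩ := S.exists_isDisintegration (prodLinearMap mG mH)
    (fun l _ g => prodFunctional_ccTranslate mG mH g l) (exists_norm_prodFunctional_smul_le mG mH)
  exact ⟨mT, hmT, fun _ h => IsDisintegration.unique h hmT⟩

namespace IsDisintegration

variable (hmT : S.IsDisintegration (prodFunctional mG mH) mT)

include hmT

theorem prodFunctional_apply_one_ne_zero : mT 1 ≠ 0 := by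
  obtain ⟨w, hw0, hw⟩ := S.exists_cosetSumMap_ccOfReal_eq_one
  obtain ⟨y, hy⟩ : ∃ y, w y ≠ 0 := by
    by_contra! hzero
    have h := congr($hw (QuotientAddGroup.mk 0))
    rw [cosetSumMap_ccOfReal_mk] at h
    simp [hzero] at h
  rw [hmT.apply_one hw]
  exact prodFunctional_ccOfReal_ne_zero mG mH w hw0 hy

-- Evaluating at points of the torus identifies the `C(𝕋)`-valued average of the translates of `F`
-- as a constant function, so that `J` may be interchanged with the average.
theorem apply_comp_shift (J : C(S.Torus, ℂ) →L[ℂ] ℂ) (F : C(S.Torus, ℂ)) :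
    mT ((J : C(C(S.Torus, ℂ), ℂ)).comp (S.shift F)) = J 1 * mT F := by
  obtain ⟨w, -, hw⟩ := S.exists_cosetSumMap_ccOfReal_eq_one
  let Φ : G × H → C(S.Torus, ℂ) := fun x => ccOfReal w x • S.shift F (QuotientAddGroup.mk x)
  have hΦ : Continuous Φ := (ccOfReal w).continuous.smul
    ((S.shift F).continuous.comp QuotientAddGroup.continuous_mk)
  have hΦc : HasCompactSupport Φ := (ccOfReal w).hasCompactSupport.smul_right
  have hinterchange : ∀ J' : C(S.Torus, ℂ) →L[ℂ] ℂ,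
      mT ((J' : C(C(S.Torus, ℂ), ℂ)).comp (S.shift F)) = J' (∫ t, ∫ h, Φ (t, h) ∂mH ∂mG) := by
    intro J'
    rw [hmT.apply_eq hw, ← integral_integral_comp_comm mG mH hΦ hΦc J', prodFunctional]
    congr 1 with t
    congr 1 with h
    simp [Φ, CompactlySupportedContinuousMap.smulc_apply, mul_comm]
  have hconst : ∫ t, ∫ h, Φ (t, h) ∂mH ∂mG = mT F • (1 : C(S.Torus, ℂ)) := by
    ext η
    have heval : ((ContinuousMap.evalCLM ℂ η : C(S.Torus, ℂ) →L[ℂ] ℂ) : C(C(S.Torus, ℂ), ℂ)).comp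
        (S.shift F) = S.shift F η := by
      ext ξ
      simp [add_comm]
    have h := hinterchange (ContinuousMap.evalCLM ℂ η)
    rw [heval, hmT.apply_shift fun x g => prodFunctional_ccTranslate mG mH g x] at h
    simpa using h.symm
  rw [hinterchange, hconst, map_smul, smul_eq_mul, mul_comm]

end IsDisintegration

end Haar

end CutProjectScheme

section RegularMeasure

variable {X : Type*} [TopologicalSpace X] [MeasurableSpace X]

theorem outerRegular_add_measure (μ ν : Measure X) [μ.OuterRegular]
    [ν.OuterRegular] : (μ + ν).OuterRegular where
  outerRegular A _ r hr := by
    rw [Measure.add_apply] at hr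
    have hμ : μ A ≠ ⊤ := (lt_of_le_of_lt le_self_add hr).ne_top
    have hν : ν A ≠ ⊤ := (lt_of_le_of_lt le_add_self hr).ne_top
    obtain ⟨δ, hδ, hδr⟩ := ENNReal.lt_iff_exists_add_pos_lt.1 hr
    have hδ2 : (δ / 2 : ENNReal) ≠ 0 := by simpa using hδ.ne'
    obtain ⟨U, hAU, hU, hμU⟩ := A.exists_isOpen_lt_of_lt _ (ENNReal.lt_add_right hμ hδ2)
    obtain ⟨V, hAV, hV, hνV⟩ := A.exists_isOpen_lt_of_lt _ (ENNReal.lt_add_right hν hδ2)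
    refine ⟨U ∩ V, subset_inter hAU hAV, hU.inter hV, ?_⟩
    calc (μ + ν) (U ∩ V) ≤ (μ A + δ / 2) + (ν A + δ / 2) :=
          add_le_add ((measure_mono inter_subset_left).trans hμU.le)
            ((measure_mono inter_subset_right).trans hνV.le)
      _ = μ A + ν A + (δ / 2 + δ / 2) := by ring
      _ < r := by rwa [ENNReal.add_halves]

theorem innerRegularWRT_isCompact_isOpen_add_measure (μ ν : Measure X) [μ.Regular] [ν.Regular] :
    (μ + ν).InnerRegularWRT IsCompact IsOpen := by
  intro U hU r hr
  rw [Measure.add_apply] at hr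
  rcases eq_or_ne (μ U) 0 with hμ | hμ
  · rw [hμ, zero_add] at hr
    obtain ⟨K, hKU, hK, hrK⟩ := hU.exists_lt_isCompact hr
    exact ⟨K, hKU, hK, hrK.trans_le (Measure.le_add_left le_rfl K)⟩
  rcases eq_or_ne (ν U) 0 with hν | hν
  · rw [hν, add_zero] at hr
    obtain ⟨K, hKU, hK, hrK⟩ := hU.exists_lt_isCompact hr
    exact ⟨K, hKU, hK, hrK.trans_le (Measure.le_add_right le_rfl K)⟩
  obtain ⟨a, ha, b, hb, hab⟩ := ENNReal.exists_lt_add_of_lt_add hr hμ hν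
  obtain ⟨K, hKU, hK, haK⟩ := hU.exists_lt_isCompact ha
  obtain ⟨K', hKU', hK', hbK⟩ := hU.exists_lt_isCompact hb
  refine ⟨K ∪ K', union_subset hKU hKU', hK.union hK', hab.trans_le ?_⟩
  exact add_le_add (haK.le.trans (measure_mono subset_union_left))
    (hbK.le.trans (measure_mono subset_union_right))

theorem regular_add_measure (μ ν : Measure X) [μ.Regular] [ν.Regular] : (μ + ν).Regular where
  lt_top_of_isCompact _ hK := ENNReal.add_lt_top.2 ⟨hK.measure_lt_top, hK.measure_lt_top⟩
  toOuterRegular := outerRegular_add_measure μ ν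
  innerRegular := innerRegularWRT_isCompact_isOpen_add_measure μ ν

variable [BorelSpace X] [R1Space X] [LocallyCompactSpace X] {μ : Measure X} [μ.Regular]

theorem exists_isCutoff_measure_sdiff_le {A : Set X} (hA : MeasurableSet A) (hμA : μ A ≠ ⊤)
    {ε : ENNReal} (hε : ε ≠ 0) :
    ∃ (u : C_c(X, ℝ)) (K U : Set X), IsCutoff u K U ∧ K ⊆ A ∧ A ⊆ U ∧ μ (U \ K) ≤ ε := by
  have hε2 : ε / 2 ≠ 0 := by simpa using hε
  obtain ⟨U, hAU, hU, -, hμU⟩ := hA.exists_isOpen_sdiff_lt hμA hε2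
  obtain ⟨K, hKA, hK, -, hμK⟩ := hA.exists_isCompact_isClosed_sdiff_lt hμA hε2
  obtain ⟨u, hu⟩ := exists_isCutoff hK hU (hKA.trans hAU)
  refine ⟨u, K, U, hu, hKA, hAU, ?_⟩
  calc μ (U \ K) ≤ μ (U \ A ∪ A \ K) := measure_mono fun x hx => by
        by_cases hxA : x ∈ A
        exacts [Or.inr ⟨hxA, hx.2⟩, Or.inl ⟨hx.1, hxA⟩]
    _ ≤ ε / 2 + ε / 2 := (measure_union_le _ _).trans (add_le_add hμU.le hμK.le)
    _ = ε := ENNReal.add_halves ε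

-- Unlike in `Integrable.exists_hasCompactSupport_lintegral_sub_le`, the space need not be normal.
theorem exists_cc_lintegral_enorm_sub_le {E : Type*} [NormedAddCommGroup E] [NormedSpace ℝ E]
    {F : X → E} (hF : Integrable F μ) {ε : ENNReal} (hε : ε ≠ 0) :
    ∃ g : C_c(X, E), ∫⁻ x, ‖F x - g x‖ₑ ∂μ ≤ ε := by
  suffices H : ∃ g : X → E, eLpNorm (F - g) 1 μ ≤ ε ∧ Continuous g ∧ HasCompactSupport g by
    obtain ⟨g, hle, hg, hgc⟩ := H
    exact ⟨⟨⟨g, hg⟩, hgc⟩, by rwa [eLpNorm_one_eq_lintegral_enorm] at hle⟩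
  refine (memLp_one_iff_integrable.2 hF).induction_dense ENNReal.one_ne_top _
    (fun c A hA hμA δ hδ => ?_) ?_ ?_ hε
  · obtain ⟨u, K, U, hu, hKA, hAU, hUK⟩ := exists_isCutoff_measure_sdiff_le hA hμA.ne
      (ENNReal.div_ne_zero.2 ⟨hδ, enorm_ne_top (x := c)⟩)
    refine ⟨fun x => u x • c, ?_, by fun_prop, u.hasCompactSupport.smul_right⟩
    rw [eLpNorm_one_eq_lintegral_enorm]
    calc ∫⁻ x, ‖u x • c - A.indicator (fun _ => c) x‖ₑ ∂μ
        ≤ ∫⁻ x, (U \ K).indicator (fun _ => ‖c‖ₑ) x ∂μ :=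
          lintegral_mono (hu.enorm_smul_sub_indicator_le hKA hAU c)
      _ ≤ ‖c‖ₑ * μ (U \ K) := lintegral_indicator_const_le _ _
      _ ≤ ‖c‖ₑ * (δ / ‖c‖ₑ) := by gcongr
      _ ≤ δ := ENNReal.mul_div_le
  · rintro f g ⟨hf, hfc⟩ ⟨hg, hgc⟩
    exact ⟨hf.add hg, hfc.add hgc⟩
  · rintro g ⟨hg, hgc⟩
    exact (hg.integrable_of_hasCompactSupport hgc).aestronglyMeasurable

end RegularMeasure

namespace ComplexRadonMeasure

section Integral

variable {X : Type*} [TopologicalSpace X] (ρ : ComplexRadonMeasure X)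

theorem integrable_cc [R1Space X] {E : Type*} [NormedAddCommGroup E] (g : C_c(X, E)) :
    Integrable g ρ.variation := by
  borelize X
  have := ρ.regular
  exact (map_continuous g).integrable_of_hasCompactSupport g.hasCompactSupport

theorem integrable_mul_phase {F : X → ℂ} (hF : Integrable F ρ.variation) :
    Integrable (fun x => F x * ρ.phase x) ρ.variation :=
  hF.mul_bdd (c := 1) ρ.measurable_phase.aestronglyMeasurable
    (ae_of_all _ fun x => (ρ.norm_phase x).le)

theorem integral_add {F F' : X → ℂ} (hF : Integrable F ρ.variation)
    (hF' : Integrable F' ρ.variation) :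
    ρ.integral (fun x => F x + F' x) = ρ.integral F + ρ.integral F' := by
  rw [integral, integral, integral,
    ← MeasureTheory.integral_add (ρ.integrable_mul_phase hF) (ρ.integrable_mul_phase hF')]
  simp only [add_mul]

theorem integral_sub {F F' : X → ℂ} (hF : Integrable F ρ.variation)
    (hF' : Integrable F' ρ.variation) :
    ρ.integral (fun x => F x - F' x) = ρ.integral F - ρ.integral F' := by
  rw [integral, integral, integral,
    ← MeasureTheory.integral_sub (ρ.integrable_mul_phase hF) (ρ.integrable_mul_phase hF')]
  simp only [sub_mul]

theorem integral_const_mul (c : ℂ) (F : X → ℂ) :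
    ρ.integral (fun x => c * F x) = c * ρ.integral F := by
  rw [integral, integral, ← MeasureTheory.integral_const_mul]
  simp only [mul_assoc]

theorem integral_of_variation_eq_zero (h : ρ.variation = 0) (F : X → ℂ) : ρ.integral F = 0 := by
  rw [integral, h, integral_zero_measure]

theorem enorm_integral_le (F : X → ℂ) : ‖ρ.integral F‖ₑ ≤ ∫⁻ x, ‖F x‖ₑ ∂ρ.variation := by
  refine (enorm_integral_le_lintegral_enorm _).trans_eq (lintegral_congr fun x => ?_)
  rw [enorm_mul, ← ofReal_norm (ρ.phase x), ρ.norm_phase, ENNReal.ofReal_one, mul_one]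

theorem norm_integral_le (F : X → ℂ) : ‖ρ.integral F‖ ≤ ∫ x, ‖F x‖ ∂ρ.variation := by
  refine (norm_integral_le_integral_norm _).trans_eq ?_
  congr 1 with x
  rw [norm_mul, ρ.norm_phase, mul_one]

/-- `ρ` as a linear functional on `C_c(X)`. -/
noncomputable def toLinearMap [R1Space X] : C_c(X, ℂ) →ₗ[ℂ] ℂ where
  toFun g := ρ.integral g
  map_add' f g := ρ.integral_add (ρ.integrable_cc f) (ρ.integrable_cc g)
  map_smul' c f := ρ.integral_const_mul c f

theorem norm_integral_smul_le [R1Space X] (w : C_c(X, ℂ)) (F : C(X, ℂ)) (a : ℝ)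
    (ha : ∀ x, ‖F x‖ ≤ a) : ‖ρ.integral (F • w : C_c(X, ℂ))‖ ≤ (∫ x, ‖w x‖ ∂ρ.variation) * a := by
  refine (ρ.norm_integral_le _).trans ?_
  rw [← MeasureTheory.integral_mul_const]
  refine integral_mono (ρ.integrable_cc _).norm ((ρ.integrable_cc w).norm.mul_const a) fun x => ?_
  simp only [CompactlySupportedContinuousMap.smulc_apply, norm_smul]
  rw [mul_comm]
  gcongr
  exact ha x

theorem enorm_indicator_star_phase (K : Set X) (x : X) :
    ‖K.indicator (fun x => star (ρ.phase x)) x‖ₑ = K.indicator 1 x := by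
  by_cases hx : x ∈ K
  · rw [indicator_of_mem hx, indicator_of_mem hx, ← ofReal_norm, norm_star, ρ.norm_phase,
      ENNReal.ofReal_one, Pi.one_apply]
  · simp [hx]

theorem integral_indicator_star_phase {K : Set X} (hK : MeasurableSet[borel X] K) :
    ρ.integral (K.indicator fun x => star (ρ.phase x)) = (ρ.variation.real K : ℂ) := by
  have hone : (fun x => K.indicator (fun x => star (ρ.phase x)) x * ρ.phase x) =
      K.indicator fun _ => (1 : ℂ) := by
    ext x
    by_cases hx : x ∈ K
    · simp only [indicator_of_mem hx]
      rw [Complex.star_def, Complex.conj_mul', ρ.norm_phase, Complex.ofReal_one, one_pow]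
    · simp [hx]
  rw [integral, hone, integral_indicator hK]
  simp

theorem integrable_indicator_star_phase [T2Space X] (ρ' : ComplexRadonMeasure X) {K : Set X}
    (hK : IsCompact K) : Integrable (K.indicator fun x => star (ρ.phase x)) ρ'.variation := by
  borelize X
  have := ρ'.regular
  refine IntegrableOn.integrable_indicator ?_ hK.measurableSet
  refine Measure.integrableOn_of_bounded (M := 1) hK.measure_ne_top
    (continuous_star.measurable.comp ρ.measurable_phase).aestronglyMeasurable
    (ae_of_all _ fun x => ?_)
  rw [norm_star, ρ.norm_phase]

theorem norm_integral_sub_cc_le [R1Space X] {F : X → ℂ} (hF : Integrable F ρ.variation)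
    {g : C_c(X, ℂ)} {ε : ℝ} (hε : 0 ≤ ε)
    (hg : ∫⁻ x, ‖F x - g x‖ₑ ∂ρ.variation ≤ ENNReal.ofReal ε) :
    ‖ρ.integral F - ρ.integral g‖ ≤ ε := by
  have hle := (ρ.enorm_integral_le _).trans hg
  rwa [ρ.integral_sub hF (ρ.integrable_cc g), ← ofReal_norm,
    ENNReal.ofReal_le_ofReal_iff hε] at hle

end Integral

section Uniqueness

variable {X : Type*} [TopologicalSpace X] [LocallyCompactSpace X] {ρ₁ ρ₂ : ComplexRadonMeasure X}

theorem integral_eq_of_forall_cc [R1Space X]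
    (h : ∀ g : C_c(X, ℂ), ρ₁.integral g = ρ₂.integral g) {F : X → ℂ}
    (h₁ : Integrable F ρ₁.variation) (h₂ : Integrable F ρ₂.variation) :
    ρ₁.integral F = ρ₂.integral F := by
  refine eq_of_forall_dist_le fun ε hε => ?_
  obtain ⟨g, hg⟩ : ∃ g : C_c(X, ℂ), ∫⁻ x, ‖F x - g x‖ₑ ∂(ρ₁.variation + ρ₂.variation) ≤
      ENNReal.ofReal (ε / 2) := by
    borelize X
    have := ρ₁.regular
    have := ρ₂.regular
    have := regular_add_measure ρ₁.variation ρ₂.variation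
    exact exists_cc_lintegral_enorm_sub_le (h₁.add_measure h₂) (by simpa using hε)
  rw [lintegral_add_measure] at hg
  have hg₁ := ρ₁.norm_integral_sub_cc_le h₁ (half_pos hε).le (le_self_add.trans hg)
  have hg₂ := ρ₂.norm_integral_sub_cc_le h₂ (half_pos hε).le (le_add_self.trans hg)
  calc dist (ρ₁.integral F) (ρ₂.integral F)
      ≤ dist (ρ₁.integral F) (ρ₁.integral g) + dist (ρ₂.integral F) (ρ₁.integral g) :=
        dist_triangle_right _ _ _
    _ ≤ ε / 2 + ε / 2 := by
        rw [dist_eq_norm, dist_eq_norm, h g]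
        exact add_le_add (h g ▸ hg₁) hg₂
    _ = ε := add_halves ε

-- Testing against the conjugate of the phase of `ρ₁` on `K` recovers `|ρ₁|(K)`.
theorem variation_le_of_forall_cc [T2Space X]
    (h : ∀ g : C_c(X, ℂ), ρ₁.integral g = ρ₂.integral g) {K : Set X} (hK : IsCompact K) :
    ρ₁.variation K ≤ ρ₂.variation K := by
  have hreg := ρ₁.regular
  borelize X
  calc ρ₁.variation K = ‖ρ₁.integral (K.indicator fun x => star (ρ₁.phase x))‖ₑ := by
        rw [ρ₁.integral_indicator_star_phase hK.measurableSet, ← ofReal_norm, Complex.norm_real,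
          Real.norm_of_nonneg measureReal_nonneg, ofReal_measureReal hK.measure_ne_top]
    _ = ‖ρ₂.integral (K.indicator fun x => star (ρ₁.phase x))‖ₑ := by
        rw [integral_eq_of_forall_cc h (ρ₁.integrable_indicator_star_phase ρ₁ hK)
          (ρ₁.integrable_indicator_star_phase ρ₂ hK)]
    _ ≤ ∫⁻ x, ‖K.indicator (fun x => star (ρ₁.phase x)) x‖ₑ ∂ρ₂.variation :=
        ρ₂.enorm_integral_le _
    _ = ρ₂.variation K := by
        simp_rw [enorm_indicator_star_phase]
        exact lintegral_indicator_one hK.measurableSet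

theorem variation_eq_of_forall_cc [T2Space X]
    (h : ∀ g : C_c(X, ℂ), ρ₁.integral g = ρ₂.integral g) : ρ₁.variation = ρ₂.variation := by
  borelize X
  have := ρ₁.regular
  have := ρ₂.regular
  refine Measure.OuterRegular.ext_isOpen fun U hU => ?_
  rw [hU.measure_eq_iSup_isCompact, hU.measure_eq_iSup_isCompact]
  refine iSup_congr fun K => iSup_congr fun _ => iSup_congr fun hK => ?_
  exact le_antisymm (variation_le_of_forall_cc h hK)
    (variation_le_of_forall_cc (fun g => (h g).symm) hK)

end Uniqueness

section Variation

variable {X : Type*} [TopologicalSpace X] (ρ : ComplexRadonMeasure X)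

/-- The total variation `|ρ|`, as a (positive) complex Radon measure. -/
noncomputable def abs : ComplexRadonMeasure X where
  variation := ρ.variation
  regular := ρ.regular
  phase := 1
  measurable_phase := @measurable_const _ _ _ (borel X) 1
  norm_phase := by simp

@[simp]
theorem abs_variation : ρ.abs.variation = ρ.variation := rfl

theorem abs_integral (F : X → ℂ) : ρ.abs.integral F = ∫ x, F x ∂ρ.variation := by
  simp [integral, abs]

end Variation

section Invariant

variable {X : Type*} [TopologicalSpace X] [AddGroup X] [IsTopologicalAddGroup X]

/-- The translate of `ρ`, with `∫ F d(ρ.transl l) = ∫ F (x + l) dρ(x)`. -/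
noncomputable def transl (ρ : ComplexRadonMeasure X) (l : X) : ComplexRadonMeasure X where
  variation := @Measure.map X X (borel X) (borel X) (fun x => x + l) ρ.variation
  regular := by
    borelize X
    have := ρ.regular
    exact Measure.Regular.map (Homeomorph.addRight l)
  phase x := ρ.phase (x - l)
  measurable_phase := by
    borelize X
    exact ρ.measurable_phase.comp (continuous_sub_right l).measurable
  norm_phase x := ρ.norm_phase _

theorem transl_integral (ρ : ComplexRadonMeasure X) (l : X) (F : X → ℂ) :
    (ρ.transl l).integral F = ρ.integral fun x => F (x + l) := by
  borelize X
  refine ((Homeomorph.addRight l).measurableEmbedding.integral_map (μ := ρ.variation)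
    (fun x => F x * ρ.phase (x - l))).trans ?_
  simp [integral]

namespace IsInvariant

variable [LocallyCompactSpace X] [T2Space X] {ρ : ComplexRadonMeasure X} {L : AddSubgroup X}

theorem transl_variation (hρ : ρ.IsInvariant L) {l : X} (hl : l ∈ L) :
    (ρ.transl l).variation = ρ.variation :=
  variation_eq_of_forall_cc fun g => (transl_integral ρ l g).trans (hρ l hl g)

theorem integral_add_right (hρ : ρ.IsInvariant L) {l : X} (hl : l ∈ L)
    {F : X → ℂ} (hF : Integrable F ρ.variation) :
    ρ.integral (fun x => F (x + l)) = ρ.integral F := by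
  rw [← transl_integral]
  exact integral_eq_of_forall_cc (fun g => (transl_integral ρ l g).trans (hρ l hl g))
    (by rwa [hρ.transl_variation hl]) hF

theorem abs (hρ : ρ.IsInvariant L) : ρ.abs.IsInvariant L := by
  borelize X
  intro l hl g
  rw [abs_integral, abs_integral]
  conv_rhs => rw [← hρ.transl_variation hl]
  exact ((Homeomorph.addRight l).measurableEmbedding.integral_map (μ := ρ.variation) g).symm

theorem existsUnique_isDisintegration {G H : Type*} [AddCommGroup G] [TopologicalSpace G]
    [IsTopologicalAddGroup G] [LocallyCompactSpace G] [T2Space G] [AddCommGroup H]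
    [TopologicalSpace H] [IsTopologicalAddGroup H] [LocallyCompactSpace H] [T2Space H]
    {S : CutProjectScheme G H} {ρ : ComplexRadonMeasure (G × H)} (hρ : ρ.IsInvariant S.lattice) :
    ∃! ρT : C(S.Torus, ℂ) →L[ℂ] ℂ, S.IsDisintegration (fun g => ρ.integral g) ρT := by
  obtain ⟨ρT, hρT⟩ := S.exists_isDisintegration ρ.toLinearMap hρ
    fun w => ⟨_, ρ.norm_integral_smul_le w⟩
  exact ⟨ρT, hρT, fun _ h => CutProjectScheme.IsDisintegration.unique h hρT⟩

end IsInvariant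

end Invariant

end ComplexRadonMeasure

section UniformConvergence

theorem norm_sub_smul_one_le {X : Type*} [TopologicalSpace X] [CompactSpace X]
    (J : C(X, ℂ) →L[ℂ] ℂ) (hJ : J 1 ≠ 0) {F : C(X, ℂ)} {a : ℝ} (ha : 0 ≤ a)
    (hF : ∀ ξ ζ, ‖F ζ - F ξ‖ ≤ a) : ‖F - (J F / J 1) • 1‖ ≤ ‖J‖ / ‖J 1‖ * a := by
  refine (ContinuousMap.norm_le _ (by positivity)).2 fun ζ => ?_
  have hζ : ‖F ζ • (1 : C(X, ℂ)) - F‖ ≤ a :=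
    (ContinuousMap.norm_le _ ha).2 fun ξ => by simpa using hF ξ ζ
  calc ‖F ζ - (J F / J 1) * 1‖ = ‖J (F ζ • 1 - F)‖ / ‖J 1‖ := by
        rw [← norm_div, map_sub, map_smul, smul_eq_mul, sub_div, mul_div_cancel_right₀ _ hJ,
          mul_one]
    _ ≤ ‖J‖ * a / ‖J 1‖ := by gcongr; exact (J.le_opNorm _).trans (by gcongr)
    _ = ‖J‖ / ‖J 1‖ * a := by ring

theorem tendsto_of_eventually_norm_sub_le {X ι : Type*} [TopologicalSpace X] [CompactSpace X]
    {l : Filter ι} (J : C(X, ℂ) →L[ℂ] ℂ) (hJ : J 1 ≠ 0) {F : ι → C(X, ℂ)} {c : ℂ}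
    (hosc : ∀ η : ℝ, 0 < η → ∀ᶠ n in l, ∀ ξ ζ, ‖F n ζ - F n ξ‖ ≤ η)
    (hlim : Tendsto (fun n => J (F n)) l (𝓝 c)) : Tendsto F l (𝓝 ((c / J 1) • 1)) := by
  have hzero : Tendsto (fun n => F n - (J (F n) / J 1) • 1) l (𝓝 0) := by
    refine Metric.tendsto_nhds.2 fun ε hε => ?_
    filter_upwards [hosc (ε / (‖J‖ / ‖J 1‖ + 1)) (by positivity)] with n hn
    rw [dist_zero_right]
    calc ‖F n - (J (F n) / J 1) • 1‖ ≤ ‖J‖ / ‖J 1‖ * (ε / (‖J‖ / ‖J 1‖ + 1)) :=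
          norm_sub_smul_one_le J hJ (by positivity) hn
      _ < (‖J‖ / ‖J 1‖ + 1) * (ε / (‖J‖ / ‖J 1‖ + 1)) := by gcongr; linarith
      _ = ε := mul_div_cancel₀ _ (by positivity)
  simpa using hzero.add ((hlim.div_const (J 1)).smul_const 1)

theorem tendstoUniformly_const_of_approx {X ι : Type*} {l : Filter ι} {f : ι → X → ℂ} {c : ℂ}
    (happ : ∀ ε : ℝ, 0 < ε → ∃ (g : ι → X → ℂ) (b : ℂ),
      TendstoUniformly g (fun _ => b) l ∧ ‖b - c‖ ≤ ε ∧ ∀ᶠ n in l, ∀ x, ‖f n x - g n x‖ ≤ ε) :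
    TendstoUniformly f (fun _ => c) l := by
  refine Metric.tendstoUniformly_iff.2 fun ε hε => ?_
  obtain ⟨g, b, hg, hb, hfg⟩ := happ (ε / 3) (by positivity)
  filter_upwards [hfg, Metric.tendstoUniformly_iff.1 hg (ε / 3) (by positivity)] with n hfn hgn x
  calc dist c (f n x) ≤ dist c b + dist b (g n x) + dist (g n x) (f n x) := dist_triangle4 _ _ _ _
    _ < ε / 3 + ε / 3 + ε / 3 := by
      refine add_lt_add_of_lt_of_le (add_lt_add_of_le_of_lt ?_ (hgn x)) ?_
      · rwa [dist_comm, dist_eq_norm]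
      · rw [dist_comm, dist_eq_norm]; exact hfn x
    _ = ε := add_thirds ε

end UniformConvergence

section Cutoff

theorem exists_forall_enorm_le {X E : Type*} [TopologicalSpace X] [NormedAddCommGroup E]
    (f : C_c(X, E)) : ∃ C ≠ (⊤ : ENNReal), ∀ x, ‖f x‖ₑ ≤ C := by
  obtain ⟨C, hC⟩ := f.hasCompactSupport.exists_bound_of_continuous f.continuous
  exact ⟨ENNReal.ofReal C, ENNReal.ofReal_ne_top, fun x =>
    ofReal_norm (f x) ▸ ENNReal.ofReal_le_ofReal (hC x)⟩

theorem enorm_le_mul_indicator {X E : Type*} [NormedAddCommGroup E] {f : X → E} {C : ENNReal}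
    {A : Set X} (hC : ∀ x, ‖f x‖ₑ ≤ C) (hA : ∀ x ∉ A, f x = 0) (x : X) :
    ‖f x‖ₑ ≤ C * A.indicator 1 x := by
  by_cases hx : x ∈ A
  · simpa [hx] using hC x
  · simp [hx, hA x hx]

theorem exists_forall_enorm_le_mul_indicator {X E : Type*} [TopologicalSpace X]
    [NormedAddCommGroup E] (f : C_c(X, E)) :
    ∃ C ≠ (⊤ : ENNReal), ∀ x, ‖f x‖ₑ ≤ C * (tsupport f).indicator 1 x := by
  obtain ⟨C, hC, hfC⟩ := exists_forall_enorm_le f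
  exact ⟨C, hC, enorm_le_mul_indicator hfC fun x hx => image_eq_zero_of_notMem_tsupport hx⟩

theorem norm_div_measureReal_le {X : Type*} [MeasurableSpace X] {μ : Measure X} {A : Set X}
    (hA : μ A ≠ ⊤) {z : ℂ} {η : ℝ} (hη : 0 ≤ η) (hz : ‖z‖ₑ ≤ ENNReal.ofReal η * μ A) :
    ‖z / μ.real A‖ ≤ η := by
  rw [← ofReal_measureReal hA, ← ENNReal.ofReal_mul hη, ← ofReal_norm,
    ENNReal.ofReal_le_ofReal_iff (by positivity)] at hz
  rw [norm_div, Complex.norm_real, Real.norm_of_nonneg measureReal_nonneg]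
  exact div_le_of_le_mul₀ measureReal_nonneg hη hz

variable {G : Type*} [AddCommGroup G] [TopologicalSpace G] {u : C_c(G, ℝ)} {B K D : Set G}

theorem IsCutoff.enorm_sub_le_one {X : Type*} [TopologicalSpace X] {u : C_c(X, ℝ)} {K U : Set X}
    (hu : IsCutoff u K U) (x y : X) : ‖u x - u y‖ₑ ≤ 1 := by
  rw [← enorm_one (G := ℝ), enorm_le_iff_norm_le, norm_one, Real.norm_eq_abs, abs_le]
  constructor <;> linarith [hu.nonneg x, hu.nonneg y, hu.le_one x, hu.le_one y]

theorem IsCutoff.apply_add_eq (hu : IsCutoff u B (B + K)) (hK0 : 0 ∈ K) (hKD : K ⊆ D) {c t : G}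
    (hc : ∀ k ∈ K, k - c ∈ D) (ht : t ∉ thickBoundary D B) : u (t + c) = u t := by
  rcases not_and_or.1 ht with ht | ht
  · have htc : t + c ∉ B + K := fun ⟨b, hb, k, hk, hbk⟩ =>
      ht ⟨b, hb, k - c, hc k hk, by simpa [← add_sub_assoc, sub_eq_iff_eq_add] using hbk⟩
    rw [hu.eq_zero _ htc, hu.eq_zero _ fun h => ht (add_subset_add_left hKD h)]
  · have htB : t ∈ B := by_contra fun h => ht ⟨t, h, 0, hKD hK0, add_zero t⟩
    have htcB : t + c ∈ B := by_contra fun h => ht ⟨t + c, h, 0 - c, hc 0 hK0, by simp⟩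
    rw [hu.eq_one _ htB, hu.eq_one _ htcB]

theorem IsCutoff.enorm_indicator_sub_le (hu : IsCutoff u B (B + K)) (hK0 : 0 ∈ K) (t : G) :
    ‖B.indicator 1 t - (u t : ℂ)‖ₑ ≤ (thickBoundary K B).indicator 1 t := by
  by_cases htB : t ∈ B
  · simp [htB, hu.eq_one t htB]
  by_cases htK : t ∈ B + K
  · have ht : t ∈ thickBoundary K B := ⟨htK, t, htB, 0, hK0, add_zero t⟩
    simpa [htB, ht, htK, ← ofReal_norm] using hu.enorm_le_indicator t
  · simp [htB, hu.eq_zero t htK]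

end Cutoff

section Tensor

variable {G H : Type*} [AddCommGroup G] [TopologicalSpace G] [R1Space G]
  [AddCommGroup H] [TopologicalSpace H] [R1Space H]

theorem IsCutoff.enorm_ccTensor_add_sub_le {u : C_c(G, ℝ)} {B U A : Set G} (hu : IsCutoff u B U)
    {c : G} (hA : ∀ t ∉ A, u (t + c) = u t) {f : C_c(H, ℂ)} {Q : Set H} {v : H} {C δ : ENNReal}
    (hC : ∀ h, ‖f h‖ₑ ≤ C) (hδ : ∀ h, ‖f (h + v) - f h‖ₑ ≤ δ)
    (hQ : ∀ h ∉ Q, f h = 0 ∧ f (h + v) = 0) (y : G × H) :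
    ‖ccTensor (ccOfReal u) f (y + (c, v)) - ccTensor (ccOfReal u) f y‖ₑ ≤
      C * (A.indicator 1 y.1 * Q.indicator 1 y.2) +
        δ * (U.indicator 1 y.1 * Q.indicator 1 y.2) := by
  obtain ⟨t, h⟩ := y
  have hu_add : ‖(u (t + c) : ℂ) - u t‖ₑ ≤ 1 * A.indicator 1 t :=
    enorm_le_mul_indicator (f := fun t => (u (t + c) : ℂ) - u t)
      (fun t => by simpa [← Complex.ofReal_sub, ← ofReal_norm] using hu.enorm_sub_le_one (t + c) t)
      (fun t ht => by rw [hA t ht, sub_self]) t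
  have hf_add : ‖f (h + v)‖ₑ ≤ C * Q.indicator 1 h :=
    enorm_le_mul_indicator (f := fun h => f (h + v)) (fun h => hC _) (fun h hh => (hQ h hh).2) h
  have hf_sub : ‖f (h + v) - f h‖ₑ ≤ δ * Q.indicator 1 h :=
    enorm_le_mul_indicator (f := fun h => f (h + v) - f h) hδ
      (fun h hh => by rw [(hQ h hh).1, (hQ h hh).2, sub_zero]) h
  have hu_le : ‖(u t : ℂ)‖ₑ ≤ U.indicator 1 t := by
    simpa [← ofReal_norm] using hu.enorm_le_indicator t
  simp only [Prod.mk_add_mk, ccTensor_apply, ccOfReal_apply]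
  calc ‖(u (t + c) : ℂ) * f (h + v) - u t * f h‖ₑ
      = ‖((u (t + c) : ℂ) - u t) * f (h + v) + u t * (f (h + v) - f h)‖ₑ := by congr 1; ring
    _ ≤ ‖(u (t + c) : ℂ) - u t‖ₑ * ‖f (h + v)‖ₑ + ‖(u t : ℂ)‖ₑ * ‖f (h + v) - f h‖ₑ := by
        rw [← enorm_mul, ← enorm_mul]
        exact enorm_add_le _ _
    _ ≤ 1 * A.indicator 1 t * (C * Q.indicator 1 h) +
          U.indicator 1 t * (δ * Q.indicator 1 h) := by gcongr
    _ = C * (A.indicator 1 t * Q.indicator 1 h) + δ * (U.indicator 1 t * Q.indicator 1 h) := by ring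

end Tensor

theorem lintegral_sum_dirac_borel {X ι : Type*} [TopologicalSpace X] [T1Space X] (p : ι → X)
    (F : X → ENNReal) :
    ∫⁻ y, F y ∂(Measure.sum fun i => @Measure.dirac _ (borel X) (p i)) = ∑' i, F (p i) := by
  borelize X
  rw [lintegral_sum_measure]
  exact tsum_congr fun i => lintegral_dirac (p i) F

namespace CutProjectScheme

variable {G H : Type*} [AddCommGroup G] [TopologicalSpace G] [AddCommGroup H] [TopologicalSpace H]

/-- The sum of the unit masses at the points of the lattice. -/
noncomputable def latticeMeasure (S : CutProjectScheme G H) : @Measure (G × H) (borel (G × H)) :=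
  Measure.sum fun l : S.lattice => @Measure.dirac _ (borel (G × H)) (l : G × H)

theorem lintegral_latticeMeasure [T1Space G] [T1Space H] (S : CutProjectScheme G H)
    (F : G × H → ENNReal) : ∫⁻ y, F y ∂S.latticeMeasure = ∑' l : S.lattice, F l :=
  lintegral_sum_dirac_borel _ F

variable [IsTopologicalAddGroup G] [LocallyCompactSpace G] [T2Space G]
  [IsTopologicalAddGroup H] [LocallyCompactSpace H] [T2Space H]

theorem translationBounded_latticeMeasure (S : CutProjectScheme G H) :
    TranslationBounded S.latticeMeasure := by
  intro g
  refine ⟨‖S.cosetSumMap (ccOfReal (ccNorm g))‖ₑ, enorm_ne_top, fun x => ?_⟩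
  have hsum : Summable fun l : S.lattice => ‖g (x + l)‖ := by
    simpa using S.summable_lattice (ccNorm g) x
  calc ∫⁻ y, ‖g (y + x)‖ₑ ∂S.latticeMeasure = ∑' l : S.lattice, ENNReal.ofReal ‖g (x + l)‖ := by
        rw [lintegral_latticeMeasure]
        exact tsum_congr fun l => by rw [ofReal_norm, add_comm]
    _ = ‖S.cosetSumMap (ccOfReal (ccNorm g)) (QuotientAddGroup.mk x)‖ₑ := by
        rw [← ENNReal.ofReal_tsum_of_nonneg (fun _ => norm_nonneg _) hsum, cosetSumMap_ccOfReal_mk,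
          ← ofReal_norm, Complex.norm_real, Real.norm_of_nonneg (tsum_nonneg fun _ => by simp)]
        simp
    _ ≤ ‖S.cosetSumMap (ccOfReal (ccNorm g))‖ₑ :=
        enorm_le_iff_norm_le.2 (ContinuousMap.norm_coe_le_norm _ _)

theorem enorm_cosetSumMap_ccTensor_sub_le (S : CutProjectScheme G H) {u : C_c(G, ℝ)}
    {B U A : Set G} (hu : IsCutoff u B U) {c : G} (hA : ∀ t ∉ A, u (t + c) = u t) {f : C_c(H, ℂ)}
    {Q : Set H} {v : H} {C δ : ENNReal} (hC : ∀ h, ‖f h‖ₑ ≤ C)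
    (hδ : ∀ h, ‖f (h + v) - f h‖ₑ ≤ δ) (hQ : ∀ h ∉ Q, f h = 0 ∧ f (h + v) = 0) (x : G × H) :
    ‖S.cosetSumMap (ccTensor (ccOfReal u) f) (QuotientAddGroup.mk (x + (c, v))) -
        S.cosetSumMap (ccTensor (ccOfReal u) f) (QuotientAddGroup.mk x)‖ₑ ≤
      C * stripLIntegral S.latticeMeasure A (Q.indicator 1) x +
        δ * stripLIntegral S.latticeMeasure U (Q.indicator 1) x := by
  set g := ccTensor (ccOfReal u) f
  rw [cosetSumMap_apply_mk, cosetSumMap_apply_mk,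
    ← (S.summable_lattice g _).tsum_sub (S.summable_lattice g _), stripLIntegral, stripLIntegral,
    lintegral_latticeMeasure, lintegral_latticeMeasure, ← ENNReal.tsum_mul_left,
    ← ENNReal.tsum_mul_left, ← ENNReal.tsum_add]
  refine enorm_tsum_le_tsum_enorm.trans (ENNReal.tsum_le_tsum fun l => ?_)
  rw [add_right_comm x, add_comm x]
  exact hu.enorm_ccTensor_add_sub_le hA hC hδ hQ (l + x)

end CutProjectScheme

namespace CutProjectScheme

variable {G H : Type*} [AddCommGroup G] [TopologicalSpace G] [IsTopologicalAddGroup G]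
  [LocallyCompactSpace G] [T2Space G] [MeasurableSpace G] [BorelSpace G]
  [AddCommGroup H] [TopologicalSpace H] [IsTopologicalAddGroup H]
  [LocallyCompactSpace H] [T2Space H] [MeasurableSpace H] [BorelSpace H]
  {mG : Measure G} [mG.IsAddHaarMeasure] {B : ℕ → Set G} {K : Set G} {u : ℕ → C_c(G, ℝ)}

theorem eventually_enorm_cosetSumMap_sub_le (S : CutProjectScheme G H) (hB : IsVanHove mG B)
    (hK : IsCompact K) (hK0 : 0 ∈ K) (hu : ∀ n, IsCutoff (u n) (B n) (B n + K)) (f : C_c(H, ℂ))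
    {η : ENNReal} (hη : η ≠ 0) :
    ∀ᶠ n in atTop, ∀ ξ ζ, ‖S.cosetSumMap (ccTensor (ccOfReal (u n)) f) ζ -
      S.cosetSumMap (ccTensor (ccOfReal (u n)) f) ξ‖ₑ ≤ η * mG (B n) := by
  have hη2 : η / 2 ≠ 0 := by simpa using hη
  have hv := S.translationBounded_latticeMeasure
  obtain ⟨C, hC, hfC⟩ := exists_forall_enorm_le f
  obtain ⟨V, hV, hV0, hVs⟩ := exists_symm_compact_nhds_zero (G := H)
  set Q := tsupport f + V
  have hQc : IsCompact Q := f.hasCompactSupport.isCompact.add hV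
  obtain ⟨M, hM, hMn⟩ := hv.exists_eventually_stripLIntegral_le hB hK hQc
  obtain ⟨δ, hδ, hδM⟩ := ENNReal.exists_nnreal_pos_mul_lt hM hη2
  obtain ⟨W, hW, hfW⟩ := exists_nhds_zero_forall_norm_sub_le f (NNReal.coe_pos.2 hδ)
  obtain ⟨P, hP, hPmk⟩ := S.exists_isCompact_forall_exists_mem_mk_eq (inter_mem hW hV0)
  set D := (K ∪ (K - P)) ∪ -(K ∪ (K - P)) with hD
  have hKP : IsCompact (K ∪ (K - P)) := hK.union (isCompact_sub hK hP)
  have hDc : IsCompact D := hKP.union hKP.neg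
  have hDs : -D = D := by rw [hD, union_neg, neg_neg, union_comm]
  filter_upwards [hMn, hv.eventually_stripLIntegral_thickBoundary_le hB hDc hDs hQc
    (ENNReal.div_pos hη2 hC).ne'] with n hMn hbd ξ ζ
  obtain ⟨x, rfl⟩ := QuotientAddGroup.mk_surjective ξ
  obtain ⟨c, hc, v, ⟨hvW, hvV⟩, hcv⟩ := hPmk (ζ - QuotientAddGroup.mk x)
  obtain rfl : QuotientAddGroup.mk (x + (c, v)) = ζ := by
    rw [QuotientAddGroup.mk_add, hcv, add_sub_cancel]
  have hconst : ∀ t ∉ thickBoundary D (B n), u n (t + c) = u n t := fun t ht =>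
    (hu n).apply_add_eq hK0 (subset_union_left.trans subset_union_left)
      (fun k hk => Or.inl (Or.inr (sub_mem_sub hk hc))) ht
  have hsupp : ∀ h ∉ Q, f h = 0 ∧ f (h + v) = 0 := fun h hh =>
    ⟨by_contra fun hne => hh ⟨h, subset_tsupport _ hne, 0, mem_of_mem_nhds hV0, add_zero h⟩,
      by_contra fun hne => hh ⟨h + v, subset_tsupport _ hne, -v, hVs ▸ neg_mem_neg.2 hvV, by simp⟩⟩
  calc _ ≤ C * (η / 2 / C * mG (B n)) + δ * (M * mG (B n)) :=
        (S.enorm_cosetSumMap_ccTensor_sub_le (hu n) hconst hfC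
          (fun h => enorm_le_coe.2 (hfW v hvW h)) hsupp x).trans
          (add_le_add (mul_le_mul_right (hbd x) C) (mul_le_mul_right (hMn x) δ))
    _ ≤ η / 2 * mG (B n) + η / 2 * mG (B n) := by
        rw [← mul_assoc, ← mul_assoc]
        gcongr
        exact ENNReal.mul_div_le
    _ = η * mG (B n) := by rw [← add_mul, ENNReal.add_halves]

end CutProjectScheme

theorem IsVanHove.tendsto_integral_cutoff_div {G : Type*} [AddCommGroup G] [TopologicalSpace G]
    [IsTopologicalAddGroup G] [MeasurableSpace G] [BorelSpace G] {mG : Measure G}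
    [IsFiniteMeasureOnCompacts mG] {B : ℕ → Set G} (hB : IsVanHove mG B) {K : Set G}
    (hK : IsCompact K) {u : ℕ → C_c(G, ℝ)} (hu : ∀ n, IsCutoff (u n) (B n) (B n + K)) :
    Tendsto (fun n => (∫ t, u n t ∂mG) / mG.real (B n)) atTop (𝓝 1) := by
  have hpos : ∀ n, 0 < mG.real (B n) := fun n =>
    ENNReal.toReal_pos (hB.pos n).ne' (hB.measure_ne_top n)
  have hint : ∀ n, ∫ t, u n t ∂mG = (∫⁻ t, ‖u n t‖ₑ ∂mG).toReal := fun n => by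
    rw [← integral_norm_eq_lintegral_enorm (map_continuous (u n)).aestronglyMeasurable]
    exact integral_congr_ae (ae_of_all _ fun t => (Real.norm_of_nonneg ((hu n).nonneg t)).symm)
  have hle : ∀ n, ∫⁻ t, ‖u n t‖ₑ ∂mG ≤ mG (B n + K) := fun n =>
    (lintegral_mono ((hu n).enorm_le_indicator)).trans (lintegral_indicator_one_le _)
  have hge : ∀ n, mG (B n) ≤ ∫⁻ t, ‖u n t‖ₑ ∂mG := fun n =>
    (lintegral_indicator_one (hB.measurableSet n)).symm.trans_le
      (lintegral_mono (hu n).indicator_le_enorm)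
  refine tendsto_order.2 ⟨fun a ha => Eventually.of_forall fun n => ha.trans_le ?_, fun a ha => ?_⟩
  · rw [one_le_div (hpos n), hint]
    exact ENNReal.toReal_mono (ne_top_of_le_ne_top (hB.measure_add_ne_top hK n) (hle n)) (hge n)
  · have hδ : 0 < (a - 1) / 2 := by linarith
    filter_upwards [hB.eventually_add_le hK (ENNReal.ofReal_pos.2 hδ).ne'] with n hn
    have htop : (1 + ENNReal.ofReal ((a - 1) / 2)) * mG (B n) ≠ ⊤ :=
      ENNReal.mul_ne_top (by simp) (hB.measure_ne_top n)
    have hreal := ENNReal.toReal_mono htop ((hle n).trans hn)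
    rw [ENNReal.toReal_mul, ENNReal.toReal_add ENNReal.one_ne_top ENNReal.ofReal_ne_top,
      ENNReal.toReal_one, ENNReal.toReal_ofReal hδ.le, ← hint] at hreal
    calc (∫ t, u n t ∂mG) / mG.real (B n) ≤ 1 + (a - 1) / 2 := (div_le_iff₀ (hpos n)).2 hreal
      _ < a := by linarith

namespace CutProjectScheme

section Averages

variable {G H : Type*} [AddCommGroup G] [TopologicalSpace G] [IsTopologicalAddGroup G]
  [LocallyCompactSpace G] [AddCommGroup H] [TopologicalSpace H] [IsTopologicalAddGroup H]
  [LocallyCompactSpace H] {S : CutProjectScheme G H}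

theorem continuous_comp_shift (J : C(S.Torus, ℂ) →L[ℂ] ℂ) :
    Continuous fun F => (J : C(C(S.Torus, ℂ), ℂ)).comp (S.shift F) :=
  (ContinuousMap.continuous_postcomp _).comp
    (ContinuousMap.continuous_curry.comp (ContinuousMap.continuous_precomp
      ⟨fun p : S.Torus × S.Torus => p.2 + p.1, continuous_snd.add continuous_fst⟩))

variable [T2Space G] [T2Space H]

theorem IsDisintegration.integral_ccTranslate {ρ : ComplexRadonMeasure (G × H)}
    {ρT : C(S.Torus, ℂ) →L[ℂ] ℂ} (hρT : S.IsDisintegration (fun g => ρ.integral g) ρT)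
    (g : C_c(G × H, ℂ)) (x : G × H) :
    ρ.integral (ccTranslate g x) = ρT (S.shift (S.cosetSumMap g) (QuotientAddGroup.mk x)) := by
  rw [← cosetSumMap_ccTranslate]
  exact hρT _

variable [MeasurableSpace G] [BorelSpace G] [MeasurableSpace H] [BorelSpace H]
  {mG : Measure G} [mG.IsAddHaarMeasure] {mH : Measure H} [mH.IsAddHaarMeasure]
  {mT : C(S.Torus, ℂ) →L[ℂ] ℂ} {B : ℕ → Set G} {K : Set G} {u : ℕ → C_c(G, ℝ)}

theorem tendsto_smul_cosetSumMap (hmT : S.IsDisintegration (prodFunctional mG mH) mT)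
    (hB : IsVanHove mG B) (hK : IsCompact K) (hK0 : 0 ∈ K)
    (hu : ∀ n, IsCutoff (u n) (B n) (B n + K)) (f : C_c(H, ℂ)) :
    Tendsto (fun n => (mG.real (B n) : ℂ)⁻¹ • S.cosetSumMap (ccTensor (ccOfReal (u n)) f)) atTop
      (𝓝 (((∫ h, f h ∂mH) / mT 1) • 1)) := by
  refine tendsto_of_eventually_norm_sub_le mT hmT.prodFunctional_apply_one_ne_zero
    (fun η hη => ?_) ?_
  · filter_upwards [S.eventually_enorm_cosetSumMap_sub_le hB hK hK0 hu f
      (ENNReal.ofReal_pos.2 hη).ne'] with n hn ξ ζ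
    simpa [← mul_sub, div_eq_inv_mul] using
      norm_div_measureReal_le (hB.measure_ne_top n) hη.le (hn ξ ζ)
  · have hmTn : ∀ n, mT ((mG.real (B n) : ℂ)⁻¹ • S.cosetSumMap (ccTensor (ccOfReal (u n)) f)) =
        (((∫ t, u n t ∂mG) / mG.real (B n) : ℝ) : ℂ) * ∫ h, f h ∂mH := fun n => by
      rw [map_smul, ← hmT, prodFunctional_ccTensor]
      simp only [ccOfReal_apply, integral_complex_ofReal, smul_eq_mul, Complex.ofReal_div]
      ring
    simp_rw [hmTn]
    simpa using ((Complex.continuous_ofReal.tendsto _).comp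
      (hB.tendsto_integral_cutoff_div hK hu)).mul_const (∫ h, f h ∂mH)

theorem tendstoUniformly_integral_ccTranslate {ρ : ComplexRadonMeasure (G × H)}
    {ρT : C(S.Torus, ℂ) →L[ℂ] ℂ} (hρT : S.IsDisintegration (fun g => ρ.integral g) ρT)
    (hmT : S.IsDisintegration (prodFunctional mG mH) mT)
    (hB : IsVanHove mG B) (hK : IsCompact K) (hK0 : 0 ∈ K)
    (hu : ∀ n, IsCutoff (u n) (B n) (B n + K)) (f : C_c(H, ℂ)) :
    TendstoUniformly
      (fun n x => ρ.integral (ccTranslate (ccTensor (ccOfReal (u n)) f) x) / mG.real (B n))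
      (fun _ => ρT 1 / mT 1 * ∫ h, f h ∂mH) atTop := by
  have hlim := ContinuousMap.tendsto_iff_tendstoUniformly.1
    (((continuous_comp_shift ρT).tendsto _).comp (tendsto_smul_cosetSumMap hmT hB hK hK0 hu f))
  convert hlim.comp (QuotientAddGroup.mk : G × H → S.Torus) using 1
  · ext n x
    have hshift : S.shift ((mG.real (B n) : ℂ)⁻¹ • S.cosetSumMap (ccTensor (ccOfReal (u n)) f))
        (QuotientAddGroup.mk x) = (mG.real (B n) : ℂ)⁻¹ •
          S.shift (S.cosetSumMap (ccTensor (ccOfReal (u n)) f)) (QuotientAddGroup.mk x) := rfl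
    rw [hρT.integral_ccTranslate]
    simp [hshift, div_eq_inv_mul]
  · ext x
    have hshift : S.shift (((∫ h, f h ∂mH) / mT 1) • 1) (QuotientAddGroup.mk x) =
        ((∫ h, f h ∂mH) / mT 1) • 1 := rfl
    simp only [ContinuousMap.coe_comp, ContinuousMap.coe_mk, Function.comp_apply, hshift, map_smul,
      smul_eq_mul]
    ring

end Averages

end CutProjectScheme

theorem enorm_integral_ofReal_norm {X E : Type*} {m : MeasurableSpace X} {μ : Measure X}
    [NormedAddCommGroup E] {g : X → E} (hg : Integrable g μ) :
    ‖∫ x, (‖g x‖ : ℂ) ∂μ‖ₑ = ∫⁻ x, ‖g x‖ₑ ∂μ := by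
  rw [integral_complex_ofReal, ← ofReal_norm, Complex.norm_real,
    Real.norm_of_nonneg (integral_nonneg fun _ => norm_nonneg _),
    ofReal_integral_norm_eq_lintegral_enorm hg]

theorem ComplexRadonMeasure.IsInvariant.translationBounded {G H : Type*} [AddCommGroup G]
    [TopologicalSpace G] [IsTopologicalAddGroup G] [LocallyCompactSpace G] [T2Space G]
    [AddCommGroup H] [TopologicalSpace H] [IsTopologicalAddGroup H] [LocallyCompactSpace H]
    [T2Space H] {S : CutProjectScheme G H} {ρ : ComplexRadonMeasure (G × H)}
    (hρ : ρ.IsInvariant S.lattice) : TranslationBounded ρ.variation := by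
  obtain ⟨J, hJ, -⟩ := hρ.abs.existsUnique_isDisintegration
  intro g
  set F := S.cosetSumMap (ccOfReal (ccNorm g))
  refine ⟨‖(J : C(C(S.Torus, ℂ), ℂ)).comp (S.shift F)‖ₑ, enorm_ne_top, fun x => ?_⟩
  calc ∫⁻ y, ‖ccTranslate g x y‖ₑ ∂ρ.variation
      = ‖ρ.abs.integral (ccTranslate (ccOfReal (ccNorm g)) x)‖ₑ := by
        rw [abs_integral, ← enorm_integral_ofReal_norm (ρ.integrable_cc _)]
        simp
    _ = ‖J (S.shift F (QuotientAddGroup.mk x))‖ₑ := by rw [← hJ.integral_ccTranslate]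
    _ ≤ ‖(J : C(C(S.Torus, ℂ), ℂ)).comp (S.shift F)‖ₑ :=
        enorm_le_iff_norm_le.2
          (ContinuousMap.norm_coe_le_norm ((J : C(C(S.Torus, ℂ), ℂ)).comp (S.shift F)) _)

section MuIntegrand

theorem muIntegrand_add {G H : Type*} [AddCommGroup G] [AddCommGroup H] (f : H → ℂ)
    (A : Set G) (x l : G × H) :
    muIntegrand f A (x + l) = fun y => muIntegrand f A x (y + l) := by
  ext y
  simp only [muIntegrand, Prod.fst_add, Prod.snd_add, add_right_comm, add_assoc]

variable {G H : Type*} [AddCommGroup G] [TopologicalSpace G] [AddCommGroup H] [TopologicalSpace H]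
  {v : @Measure (G × H) (borel (G × H))} {A : Set G} {f : H → ℂ} {x : G × H}

theorem stripLIntegral_le_mul_of_le {q q' : H → ENNReal} {C : ENNReal} (hC : C ≠ ⊤)
    (hq : ∀ h, q h ≤ C * q' h) (x : G × H) :
    stripLIntegral v A q x ≤ C * stripLIntegral v A q' x := by
  rw [stripLIntegral, stripLIntegral, ← lintegral_const_mul' _ _ hC]
  refine lintegral_mono fun y => ?_
  rw [mul_left_comm]
  exact mul_le_mul_right (hq _) _

theorem lintegral_enorm_muIntegrand (v : @Measure (G × H) (borel (G × H))) (f : H → ℂ) (A : Set G)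
    (x : G × H) :
    ∫⁻ y, ‖muIntegrand f A x y‖ₑ ∂v = stripLIntegral v A (fun h => ‖f h‖ₑ) x := by
  refine lintegral_congr fun y => ?_
  by_cases hy : y.1 + x.1 ∈ A <;> simp [muIntegrand, hy]

theorem enorm_integral_muIntegrand_sub_le {ρ : ComplexRadonMeasure (G × H)} {f' : H → ℂ}
    (hf : Integrable (muIntegrand f A x) ρ.variation)
    (hf' : Integrable (muIntegrand f' A x) ρ.variation) :
    ‖ρ.integral (muIntegrand f A x) - ρ.integral (muIntegrand f' A x)‖ₑ ≤
      stripLIntegral ρ.variation A (fun h => ‖f h - f' h‖ₑ) x := by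
  rw [← ρ.integral_sub hf hf', ← lintegral_enorm_muIntegrand]
  refine (ρ.enorm_integral_le _).trans_eq (lintegral_congr fun y => ?_)
  simp only [muIntegrand, sub_mul]

variable [MeasurableSpace G] [BorelSpace G] [ContinuousAdd G]

theorem integrable_muIntegrand (hA : MeasurableSet A)
    (hf : @AEMeasurable (G × H) ℂ _ (borel (G × H)) (fun y => f (y.2 + x.2)) v)
    (hfin : stripLIntegral v A (fun h => ‖f h‖ₑ) x ≠ ⊤) : Integrable (muIntegrand f A x) v := by
  have hind : Measurable[borel (G × H)] fun y : G × H => A.indicator (1 : G → ℂ) (y.1 + x.1) :=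
    (measurable_one.indicator hA).comp
      (measurable_borel_of_continuous (continuous_fst.add continuous_const))
  refine ⟨(hf.mul hind.aemeasurable).aestronglyMeasurable, ?_⟩
  rw [hasFiniteIntegral_iff_enorm, lintegral_enorm_muIntegrand]
  exact lt_top_iff_ne_top.2 hfin

end MuIntegrand

section WeylConvergence

variable {G H : Type*} [AddCommGroup G] [TopologicalSpace G] [IsTopologicalAddGroup G]
  [AddCommGroup H] [TopologicalSpace H] [IsTopologicalAddGroup H]
  {S : CutProjectScheme G H} {ρ : ComplexRadonMeasure (G × H)}

theorem enorm_integral_muIntegrand_sub_integral_ccTranslate_le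
    {A K : Set G} {u : C_c(G, ℝ)} (hu : IsCutoff u A (A + K)) (hK0 : 0 ∈ K) {f : C_c(H, ℂ)}
    {C : ENNReal} (hC : C ≠ ⊤) (hfC : ∀ h, ‖f h‖ₑ ≤ C * (tsupport f).indicator 1 h) {x : G × H}
    (hint : Integrable (muIntegrand f A x) ρ.variation) :
    ‖ρ.integral (muIntegrand f A x) - ρ.integral (ccTranslate (ccTensor (ccOfReal u) f) x)‖ₑ ≤
      C * stripLIntegral ρ.variation (thickBoundary K A) ((tsupport f).indicator 1) x := by
  rw [← ρ.integral_sub hint (ρ.integrable_cc _), stripLIntegral, ← lintegral_const_mul' _ _ hC]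
  refine (ρ.enorm_integral_le _).trans (lintegral_mono fun y => ?_)
  have htensor : ccTranslate (ccTensor (ccOfReal u) f) x y = u (y.1 + x.1) * f (y.2 + x.2) := by
    simp [ccTensor_apply]
  rw [htensor, muIntegrand]
  calc ‖f (y.2 + x.2) * A.indicator 1 (y.1 + x.1) - (u (y.1 + x.1) : ℂ) * f (y.2 + x.2)‖ₑ
      = ‖A.indicator 1 (y.1 + x.1) - (u (y.1 + x.1) : ℂ)‖ₑ * ‖f (y.2 + x.2)‖ₑ := by
        rw [mul_comm, ← sub_mul, enorm_mul]
    _ ≤ (thickBoundary K A).indicator 1 (y.1 + x.1) *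
          (C * (tsupport f).indicator 1 (y.2 + x.2)) :=
        mul_le_mul' (hu.enorm_indicator_sub_le hK0 _) (hfC _)
    _ = _ := mul_left_comm _ _ _

variable [LocallyCompactSpace G] [T2Space G] [MeasurableSpace G] [BorelSpace G]
  [LocallyCompactSpace H] [T2Space H] {mG : Measure G} {B : ℕ → Set G}

theorem IsVanHove.integrable_muIntegrand_cc (hB : IsVanHove mG B)
    (hρ : ρ.IsInvariant S.lattice) (f : C_c(H, ℂ)) (n : ℕ) (x : G × H) :
    Integrable (muIntegrand f (B n) x) ρ.variation := by
  obtain ⟨C, hC, hfC⟩ := exists_forall_enorm_le_mul_indicator f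
  obtain ⟨M, hM, hMx⟩ := hρ.translationBounded.exists_stripLIntegral_isCompact_le
    (hB.relCompact n) f.hasCompactSupport.isCompact
  refine integrable_muIntegrand (hB.measurableSet n) (Measurable.aemeasurable ?_)
    (ne_top_of_le_ne_top (ENNReal.mul_ne_top hC hM) ?_)
  · exact measurable_borel_of_continuous (by fun_prop)
  · exact (stripLIntegral_le_mul_of_le hC hfC x).trans (mul_le_mul_right
      ((stripLIntegral_mono subset_closure (fun _ => le_rfl) x).trans (hMx x)) C)

theorem IsVanHove.integrable_muIntegrand_of_sub_cc (hB : IsVanHove mG B)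
    (hρ : ρ.IsInvariant S.lattice) (p : C_c(H, ℂ)) {f : H → ℂ} {n : ℕ} {x : G × H}
    (hf : @AEMeasurable (G × H) ℂ _ (borel (G × H)) (fun y => f (y.2 + x.2)) ρ.variation)
    (hfin : stripLIntegral ρ.variation (B n) (fun h => ‖f h - p h‖ₑ) x ≠ ⊤) :
    Integrable (muIntegrand f (B n) x) ρ.variation := by
  have hp : Measurable[borel (G × H)] fun y : G × H => p (y.2 + x.2) :=
    measurable_borel_of_continuous (by fun_prop)
  refine ((integrable_muIntegrand (f := fun h => f h - p h) (hB.measurableSet n)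
    (hf.sub hp.aemeasurable) hfin).add (hB.integrable_muIntegrand_cc hρ p n x)).congr
    (ae_of_all _ fun y => ?_)
  simp [muIntegrand, sub_mul]

variable [MeasurableSpace H] [BorelSpace H] [mG.IsAddHaarMeasure]
  {mH : Measure H} [mH.IsAddHaarMeasure] {ρT mT : C(S.Torus, ℂ) →L[ℂ] ℂ}

theorem tendstoUniformly_integral_muIntegrand_cc (hρ : ρ.IsInvariant S.lattice)
    (hρT : S.IsDisintegration (fun g => ρ.integral g) ρT)
    (hmT : S.IsDisintegration (prodFunctional mG mH) mT) (hB : IsVanHove mG B) (f : C_c(H, ℂ)) :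
    TendstoUniformly (fun n x => ρ.integral (muIntegrand f (B n) x) / mG.real (B n))
      (fun _ => ρT 1 / mT 1 * ∫ h, f h ∂mH) atTop := by
  obtain ⟨K, hK, hK0, hKs⟩ := exists_symm_compact_nhds_zero (G := G)
  choose u hu using fun n => exists_isCutoff_add hK0 (hB.relCompact n)
  obtain ⟨C, hC, hfC⟩ := exists_forall_enorm_le_mul_indicator f
  refine tendstoUniformly_const_of_approx fun ε hε => ⟨_, _,
    CutProjectScheme.tendstoUniformly_integral_ccTranslate hρT hmT hB hK (mem_of_mem_nhds hK0) hu f,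
    by simpa using hε.le, ?_⟩
  filter_upwards [hρ.translationBounded.eventually_stripLIntegral_thickBoundary_le hB hK hKs
    f.hasCompactSupport.isCompact (ENNReal.div_pos (ENNReal.ofReal_pos.2 hε).ne' hC).ne']
    with n hn x
  rw [← sub_div]
  refine norm_div_measureReal_le (hB.measure_ne_top n) hε.le
    ((enorm_integral_muIntegrand_sub_integral_ccTranslate_le (hu n) (mem_of_mem_nhds hK0) hC hfC
      (hB.integrable_muIntegrand_cc hρ f n x)).trans ?_)
  calc C * stripLIntegral ρ.variation (thickBoundary K (B n)) ((tsupport f).indicator 1) x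
      ≤ C * (ENNReal.ofReal ε / C * mG (B n)) := mul_le_mul_right (hn x) C
    _ ≤ ENNReal.ofReal ε * mG (B n) := by
        rw [← mul_assoc]
        gcongr
        exact ENNReal.mul_div_le

theorem weylConvergence_of_approx (hρ : ρ.IsInvariant S.lattice)
    (hρT : S.IsDisintegration (fun g => ρ.integral g) ρT)
    (hmT : S.IsDisintegration (prodFunctional mG mH) mT) {f : H → ℂ} (hf : Integrable f mH)
    (hint : ∀ B, IsVanHove mG B → ∀ n x, Integrable (muIntegrand f (B n) x) ρ.variation)
    (happ : ∀ B, IsVanHove mG B → ∀ ε : ℝ, 0 < ε → ∃ φ : C_c(H, ℂ),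
      ∫⁻ h, ‖f h - φ h‖ₑ ∂mH ≤ ENNReal.ofReal ε ∧ ∀ᶠ n in atTop, ∀ x,
        stripLIntegral ρ.variation (B n) (fun h => ‖f h - φ h‖ₑ) x ≤ ENNReal.ofReal ε * mG (B n)) :
    WeylConvergence mG S ρ f (ρT 1 / mT 1 * ∫ h, f h ∂mH) := by
  intro B hB
  refine ⟨hint B hB, fun n ξ => ρ.integral (muIntegrand f (B n) ξ.out), fun n x => ?_, ?_⟩
  · obtain ⟨l, hl⟩ := QuotientAddGroup.mk_out_eq_add S.lattice x
    simp only [hl, muIntegrand_add]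
    exact hρ.integral_add_right l.2 (hint B hB n x)
  refine tendstoUniformly_const_of_approx fun ε hε => ?_
  set a := ‖ρT 1 / mT 1‖
  have hεa : ε / (a + 1) ≤ ε := div_le_self hε.le (le_add_of_nonneg_left (norm_nonneg _))
  obtain ⟨φ, hφ, hφn⟩ := happ B hB (ε / (a + 1)) (by positivity)
  refine ⟨_, _, (tendstoUniformly_integral_muIntegrand_cc hρ hρT hmT hB φ).comp Quotient.out,
    ?_, hφn.mono fun n hn ξ => ?_⟩
  · calc ‖ρT 1 / mT 1 * (∫ h, φ h ∂mH) - ρT 1 / mT 1 * ∫ h, f h ∂mH‖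
        = a * ‖∫ h, (f h - φ h) ∂mH‖ := by
          rw [← mul_sub, norm_mul, norm_sub_rev,
            integral_sub hf
              ((map_continuous φ).integrable_of_hasCompactSupport φ.hasCompactSupport)]
      _ ≤ (a + 1) * (ε / (a + 1)) := by
          gcongr
          · linarith
          · rw [← ENNReal.ofReal_le_ofReal_iff (by positivity), ofReal_norm]
            exact (enorm_integral_le_lintegral_enorm _).trans hφ
      _ = ε := mul_div_cancel₀ _ (by positivity)
  · rw [Function.comp_apply, ← sub_div]
    refine (norm_div_measureReal_le (hB.measure_ne_top n) (by positivity) ?_).trans hεa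
    exact (enorm_integral_muIntegrand_sub_le (hint B hB n _)
      (hB.integrable_muIntegrand_cc hρ φ n _)).trans (hn _)

theorem weylConvergence_cc (hρ : ρ.IsInvariant S.lattice)
    (hρT : S.IsDisintegration (fun g => ρ.integral g) ρT)
    (hmT : S.IsDisintegration (prodFunctional mG mH) mT) (f : C_c(H, ℂ)) :
    WeylConvergence mG S ρ f (ρT 1 / mT 1 * ∫ h, f h ∂mH) :=
  weylConvergence_of_approx hρ hρT hmT
    ((map_continuous f).integrable_of_hasCompactSupport f.hasCompactSupport)
    (fun _ hB => hB.integrable_muIntegrand_cc hρ f)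
    fun _ _ _ _ => ⟨f, by simp, by simp [stripLIntegral]⟩

end WeylConvergence

section InnerRegularity

theorem iSup_indicator_min_eq {X : Type*} (g : X → ENNReal) (x : X) :
    ⨆ n : ℕ, {x | (n : ENNReal)⁻¹ < g x}.indicator (fun x => min (g x) n) x = g x := by
  refine le_antisymm (iSup_le fun n => indicator_le (fun _ _ => min_le_left _ _) x)
    (le_of_forall_lt fun a ha => ?_)
  obtain ⟨m, hm⟩ := ENNReal.exists_nat_gt ha.ne_top
  obtain ⟨k, hk⟩ := ENNReal.exists_inv_nat_lt (pos_of_gt ha).ne'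
  have hmem : x ∈ {x | ((max m k : ℕ) : ENNReal)⁻¹ < g x} :=
    (ENNReal.inv_le_inv.2 (by gcongr; exact le_max_right m k)).trans_lt hk
  refine lt_iSup_iff.2 ⟨max m k, ?_⟩
  rw [indicator_of_mem hmem]
  exact lt_min ha (hm.trans_le (by gcongr; exact le_max_left m k))

variable {X : Type*} [TopologicalSpace X] [MeasurableSpace X] [BorelSpace X]
  {μ : Measure X} [μ.Regular] {g : X → ENNReal} {M : ENNReal}

theorem measure_lt_le_div_of_forall_isCompact (hg : Continuous g)
    (hM : ∀ K, IsCompact K → ∫⁻ x in K, g x ∂μ ≤ M) {c : ENNReal} (hc : c ≠ 0) (hc' : c ≠ ⊤) :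
    μ {x | c < g x} ≤ M / c := by
  rw [(isOpen_lt continuous_const hg).measure_eq_iSup_isCompact]
  refine iSup₂_le fun K hK => iSup_le fun hKc => ?_
  rw [ENNReal.le_div_iff_mul_le (Or.inl hc) (Or.inl hc'), mul_comm]
  calc c * μ K = ∫⁻ _ in K, c ∂μ := (setLIntegral_const K c).symm
    _ ≤ ∫⁻ x in K, g x ∂μ := setLIntegral_mono hg.measurable fun x hx => (hK hx).le
    _ ≤ M := hM K hKc

theorem setLIntegral_min_le_of_forall_isCompact [R1Space X]
    (hM : ∀ K, IsCompact K → ∫⁻ x in K, g x ∂μ ≤ M) {A : Set X} (hA : MeasurableSet A)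
    (hμA : μ A ≠ ⊤) (n : ℕ) : ∫⁻ x in A, min (g x) n ∂μ ≤ M := by
  refine ENNReal.le_of_forall_pos_le_add fun ε hε _ => ?_
  have hε' : (ε : ENNReal) / n ≠ 0 := (ENNReal.div_pos (by simpa using hε.ne') (by simp)).ne'
  obtain ⟨K, hKA, hK, -, hμK⟩ := hA.exists_isCompact_isClosed_sdiff_lt hμA hε'
  calc ∫⁻ x in A, min (g x) n ∂μ
      ≤ ∫⁻ x in K, min (g x) n ∂μ + ∫⁻ x in A \ K, min (g x) n ∂μ :=
        (lintegral_mono_set (by rw [union_sdiff_cancel hKA])).trans (lintegral_union_le _ _ _)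
    _ ≤ ∫⁻ x in K, g x ∂μ + ∫⁻ _ in A \ K, n ∂μ :=
        add_le_add (lintegral_mono fun _ => min_le_left _ _)
          (lintegral_mono fun _ => min_le_right _ _)
    _ ≤ M + n * (ε / n) := by
        rw [setLIntegral_const]
        exact add_le_add (hM K hK) (mul_le_mul_right hμK.le _)
    _ ≤ M + ε := by gcongr; exact ENNReal.mul_div_le

theorem lintegral_le_of_forall_isCompact [R1Space X] (hg : Continuous g) (hMtop : M ≠ ⊤)
    (hM : ∀ K, IsCompact K → ∫⁻ x in K, g x ∂μ ≤ M) : ∫⁻ x, g x ∂μ ≤ M := by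
  have hW : ∀ n : ℕ, MeasurableSet {x | (n : ENNReal)⁻¹ < g x} := fun n =>
    measurableSet_lt measurable_const hg.measurable
  have hmono : Monotone fun (n : ℕ) x =>
      {x | (n : ENNReal)⁻¹ < g x}.indicator (fun x => min (g x) n) x := by
    intro m n hmn x
    have hinv : (n : ENNReal)⁻¹ ≤ (m : ENNReal)⁻¹ := ENNReal.inv_le_inv.2 (by exact_mod_cast hmn)
    exact (indicator_le_indicator_of_subset (fun y hy => hinv.trans_lt hy)
      (fun _ => zero_le) x).trans (indicator_le_indicator (by gcongr))
  rw [← lintegral_congr (iSup_indicator_min_eq g),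
    lintegral_iSup (fun n => (hg.measurable.min measurable_const).indicator (hW n)) hmono]
  refine iSup_le fun n => ?_
  rw [lintegral_indicator (hW n)]
  rcases eq_or_ne n 0 with rfl | hn
  · simp
  have hinv : (n : ENNReal)⁻¹ ≠ 0 := by simp
  refine setLIntegral_min_le_of_forall_isCompact hM (hW n) (ne_top_of_le_ne_top ?_
    (measure_lt_le_div_of_forall_isCompact hg hM hinv (by simpa using hn))) n
  exact ENNReal.div_ne_top hMtop hinv

end InnerRegularity

theorem IsCutoff.enorm_sub_mul_le {X : Type*} [TopologicalSpace X] {u : C_c(X, ℝ)} {K U : Set X}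
    (hu : IsCutoff u K U) (c : ℂ) (x : X) : ‖c - c * u x‖ₑ ≤ ‖c‖ₑ * Kᶜ.indicator 1 x := by
  by_cases hx : x ∈ K
  · simp [hu.eq_one x hx]
  have hle : ‖c - c * u x‖ ≤ ‖c‖ := by
    rw [← mul_one_sub, norm_mul, ← Complex.ofReal_one, ← Complex.ofReal_sub, Complex.norm_real,
      Real.norm_of_nonneg (sub_nonneg.2 (hu.le_one x))]
    exact mul_le_of_le_one_right (norm_nonneg c) (sub_le_self 1 (hu.nonneg x))
  simpa [hx] using enorm_le_iff_norm_le.2 hle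

section Admissible

variable {G H : Type*} [AddCommGroup G] [TopologicalSpace G]
  [AddCommGroup H] [TopologicalSpace H] [IsTopologicalAddGroup H] [LocallyCompactSpace H]
  {ρ : ComplexRadonMeasure (G × H)} {f : H → ℂ}

theorem IsAdmissible.exists_cc_lintegral_le [MeasurableSpace H] (hfa : IsAdmissible ρ f)
    (hf : Continuous f) (φ : C_c(G, ℂ)) {ε : ℝ} (hε : 0 < ε) :
    ∃ p : C_c(H, ℂ), ∀ x : G × H, ∫⁻ y, ‖φ (y.1 + x.1)‖ₑ * ‖f (y.2 + x.2) - p (y.2 + x.2)‖ₑ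
      ∂ρ.variation ≤ ENNReal.ofReal ε := by
  obtain ⟨Q, hQ, hQε⟩ := hfa.tight ε hε φ
  obtain ⟨θ, hθ⟩ := exists_isCutoff hQ isOpen_univ (subset_univ Q)
  refine ⟨(⟨f, hf⟩ : C(H, ℂ)) • ccOfReal θ, fun x => (lintegral_mono fun y => ?_).trans
    (hQε x.1 x.2)⟩
  rw [enorm_mul, mul_assoc]
  refine mul_le_mul_right ?_ _
  simpa [CompactlySupportedContinuousMap.smulc_apply] using
    hθ.enorm_sub_mul_le (f (y.2 + x.2)) (y.2 + x.2)

variable [IsTopologicalAddGroup G] [LocallyCompactSpace G] [T2Space G] [T2Space H]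
  {S : CutProjectScheme G H} {J : C(S.Torus, ℂ) →L[ℂ] ℂ}

theorem CutProjectScheme.IsDisintegration.abs_apply_one_ne_zero
    (hJ : S.IsDisintegration (fun g => ρ.abs.integral g) J) (h0 : ρ.variation ≠ 0) : J 1 ≠ 0 := by
  borelize (G × H)
  have := ρ.regular
  intro hJ1
  obtain ⟨w, hw0, hw⟩ := S.exists_cosetSumMap_ccOfReal_eq_one
  have hint : ∫ y, ‖ccOfReal w y‖ ∂ρ.variation = 0 := by
    have hnorm : ∀ y, ((‖ccOfReal w y‖ : ℝ) : ℂ) = ccOfReal w y := fun y => by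
      simp [abs_of_nonneg (hw0 y)]
    rw [← Complex.ofReal_eq_zero, ← integral_complex_ofReal, ← hJ1, hJ.apply_one hw,
      ρ.abs_integral]
    simp only [hnorm]
  have hJ0 : ∀ F, J F = 0 := fun F => by
    rw [hJ.apply_eq hw, ← norm_le_zero_iff]
    refine (ρ.abs.norm_integral_smul_le _ _ ‖F‖ fun x => F.norm_coe_le_norm _).trans_eq ?_
    rw [ρ.abs_variation, hint, zero_mul]
  obtain ⟨K, hK, hK0⟩ := Measure.Regular.exists_isCompact_not_null.2 h0
  obtain ⟨κ, hκ⟩ := exists_isCutoff hK isOpen_univ (subset_univ K)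
  refine hK0 (le_antisymm ?_ zero_le)
  calc ρ.variation K = ∫⁻ y, K.indicator 1 y ∂ρ.variation :=
        (lintegral_indicator_one hK.measurableSet).symm
    _ ≤ ∫⁻ y, ‖κ y‖ₑ ∂ρ.variation := lintegral_mono hκ.indicator_le_enorm
    _ = ‖ρ.abs.integral (ccOfReal (ccNorm κ))‖ₑ := by
        rw [ρ.abs_integral, ← enorm_integral_ofReal_norm (ρ.integrable_cc κ)]
        simp
    _ = 0 := by rw [enorm_eq_zero, ← hJ0 (S.cosetSumMap (ccOfReal (ccNorm κ))), ← hJ]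

variable [MeasurableSpace G] [BorelSpace G] [MeasurableSpace H] [BorelSpace H]
  {mG : Measure G} [mG.IsAddHaarMeasure] {mH : Measure H} [mH.IsAddHaarMeasure]
  {mT : C(S.Torus, ℂ) →L[ℂ] ℂ}

theorem CutProjectScheme.IsDisintegration.enorm_apply_one_mul_lintegral_le
    (hJ : S.IsDisintegration (fun g => ρ.abs.integral g) J)
    (hmT : S.IsDisintegration (prodFunctional mG mH) mT) (φ : C_c(G, ℂ)) (p : C_c(H, ℂ))
    {M : ENNReal} (hMtop : M ≠ ⊤)
    (hM : ∀ x : G × H, ∫⁻ y, ‖φ (y.1 + x.1)‖ₑ * ‖p (y.2 + x.2)‖ₑ ∂ρ.variation ≤ M) :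
    ‖J 1‖ₑ * ((∫⁻ t, ‖φ t‖ₑ ∂mG) * ∫⁻ h, ‖p h‖ₑ ∂mH) ≤ ‖mT‖ₑ * M := by
  lift M to NNReal using hMtop
  set g := ccTensor (ccOfReal (ccNorm φ)) (ccOfReal (ccNorm p))
  have hshift : ‖(J : C(C(S.Torus, ℂ), ℂ)).comp (S.shift (S.cosetSumMap g))‖ₑ ≤ M := by
    refine enorm_le_coe.2 (NNReal.coe_le_coe.1 ((ContinuousMap.norm_le _ M.2).2 fun ξ => ?_))
    obtain ⟨x, rfl⟩ := QuotientAddGroup.mk_surjective ξ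
    have hx : ‖ρ.abs.integral (ccTranslate g x)‖ₑ ≤ M := by
      refine (ρ.abs.enorm_integral_le _).trans ((lintegral_mono fun y => ?_).trans (hM x))
      simp [g, ← ofReal_norm]
    rw [hJ.integral_ccTranslate] at hx
    exact_mod_cast enorm_le_coe.1 hx
  have hφ : Integrable φ mG :=
    (map_continuous φ).integrable_of_hasCompactSupport φ.hasCompactSupport
  have hp : Integrable p mH :=
    (map_continuous p).integrable_of_hasCompactSupport p.hasCompactSupport
  calc ‖J 1‖ₑ * ((∫⁻ t, ‖φ t‖ₑ ∂mG) * ∫⁻ h, ‖p h‖ₑ ∂mH)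
      = ‖mT ((J : C(C(S.Torus, ℂ), ℂ)).comp (S.shift (S.cosetSumMap g)))‖ₑ := by
        rw [hmT.apply_comp_shift, ← hmT, prodFunctional_ccTensor, enorm_mul, enorm_mul,
          ← enorm_integral_ofReal_norm hφ, ← enorm_integral_ofReal_norm hp]
        simp
    _ ≤ ‖mT‖ₑ * M := (mT.le_opENorm _).trans (mul_le_mul_right hshift _)

theorem CutProjectScheme.IsDisintegration.lintegral_enorm_le_of_continuous [mH.Regular]
    (hJ : S.IsDisintegration (fun g => ρ.abs.integral g) J) (hJ1 : J 1 ≠ 0)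
    (hmT : S.IsDisintegration (prodFunctional mG mH) mT) (φ : C_c(G, ℂ))
    (hφ : ∫⁻ t, ‖φ t‖ₑ ∂mG ≠ 0) (hf : Continuous f) {M : ENNReal} (hMtop : M ≠ ⊤)
    (hM : ∀ x : G × H, ∫⁻ y, ‖φ (y.1 + x.1)‖ₑ * ‖f (y.2 + x.2)‖ₑ ∂ρ.variation ≤ M) :
    ∫⁻ h, ‖f h‖ₑ ∂mH ≤ ‖mT‖ₑ * M / (‖J 1‖ₑ * ∫⁻ t, ‖φ t‖ₑ ∂mG) := by
  have hpos : ‖J 1‖ₑ * ∫⁻ t, ‖φ t‖ₑ ∂mG ≠ 0 := mul_ne_zero (enorm_ne_zero.2 hJ1) hφ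
  have hfin : ‖J 1‖ₑ * ∫⁻ t, ‖φ t‖ₑ ∂mG ≠ ⊤ := ENNReal.mul_ne_top enorm_ne_top
    ((map_continuous φ).integrable_of_hasCompactSupport φ.hasCompactSupport).2.ne
  refine lintegral_le_of_forall_isCompact hf.enorm
    (ENNReal.div_ne_top (ENNReal.mul_ne_top enorm_ne_top hMtop) hpos) fun Q hQ => ?_
  obtain ⟨θ, hθ⟩ := exists_isCutoff hQ isOpen_univ (subset_univ Q)
  set p : C_c(H, ℂ) := (⟨f, hf⟩ : C(H, ℂ)) • ccOfReal θ
  have hp : ∀ h, ‖p h‖ₑ = ‖f h‖ₑ * ‖θ h‖ₑ := fun h => by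
    simp [p, CompactlySupportedContinuousMap.smulc_apply, ← ofReal_norm]
  have hpf : ∀ h, ‖p h‖ₑ ≤ ‖f h‖ₑ := fun h => by
    rw [hp]
    exact mul_le_of_le_one_right' ((hθ.enorm_le_indicator h).trans (by simp))
  rw [ENNReal.le_div_iff_mul_le (Or.inl hpos) (Or.inl hfin)]
  calc (∫⁻ h in Q, ‖f h‖ₑ ∂mH) * (‖J 1‖ₑ * ∫⁻ t, ‖φ t‖ₑ ∂mG)
      ≤ (∫⁻ h, ‖p h‖ₑ ∂mH) * (‖J 1‖ₑ * ∫⁻ t, ‖φ t‖ₑ ∂mG) := by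
        refine mul_le_mul_left ?_ _
        rw [← lintegral_indicator hQ.measurableSet]
        refine lintegral_mono fun h => ?_
        by_cases hh : h ∈ Q <;> simp [hh, hp, hθ.eq_one]
    _ = ‖J 1‖ₑ * ((∫⁻ t, ‖φ t‖ₑ ∂mG) * ∫⁻ h, ‖p h‖ₑ ∂mH) := by ring
    _ ≤ ‖mT‖ₑ * M := hJ.enorm_apply_one_mul_lintegral_le hmT φ p hMtop fun x =>
        (lintegral_mono fun y => mul_le_mul_right (hpf _) _).trans (hM x)

theorem IsAdmissible.exists_cc_approx [mH.Regular] (hfa : IsAdmissible ρ f) (hf : Continuous f)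
    (hρ : ρ.IsInvariant S.lattice) (h0 : ρ.variation ≠ 0)
    (hmT : S.IsDisintegration (prodFunctional mG mH) mT) {K : Set G} (hK : IsCompact K)
    (hK0 : K ∈ 𝓝 0) {ε : ENNReal} (hε : ε ≠ 0) :
    ∃ p : C_c(H, ℂ), ∫⁻ h, ‖f h - p h‖ₑ ∂mH ≤ ε ∧ ∀ A, mG (A + K) ≠ ⊤ → ∀ x,
      stripLIntegral ρ.variation A (fun h => ‖f h - p h‖ₑ) x ≤ ε * mG (A + K) := by
  obtain ⟨J, hJ, -⟩ := hρ.abs.existsUnique_isDisintegration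
  have hJ1 : J 1 ≠ 0 := hJ.abs_apply_one_ne_zero h0
  have hmK : mG K ≠ 0 := (Measure.measure_pos_of_mem_nhds mG hK0).ne'
  obtain ⟨u, hu⟩ := exists_isCutoff (isCompact_sub hK hK) isOpen_univ (subset_univ _)
  have hu0 : ∫⁻ t, ‖ccOfReal u t‖ₑ ∂mG ≠ 0 := by
    have hle : mG (K - K) ≤ ∫⁻ t, ‖ccOfReal u t‖ₑ ∂mG := by
      rw [← lintegral_indicator_one (isCompact_sub hK hK).measurableSet]
      exact lintegral_mono fun t => by simpa [← ofReal_norm] using hu.indicator_le_enorm t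
    have hsub : K ⊆ K - K := fun t ht => ⟨t, ht, 0, mem_of_mem_nhds hK0, sub_zero t⟩
    exact ne_bot_of_le_ne_bot hmK ((measure_mono hsub).trans hle)
  set C := ‖mT‖ₑ / (‖J 1‖ₑ * ∫⁻ t, ‖ccOfReal u t‖ₑ ∂mG)
  have hC : C ≠ ⊤ := ENNReal.div_ne_top enorm_ne_top (mul_ne_zero (enorm_ne_zero.2 hJ1) hu0)
  obtain ⟨η, hη, hηε⟩ := ENNReal.exists_nnreal_pos_mul_lt
    (ENNReal.add_ne_top.2 ⟨hC, ENNReal.inv_ne_top.2 hmK⟩) hε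
  rw [mul_add] at hηε
  obtain ⟨p, hp⟩ := hfa.exists_cc_lintegral_le hf (ccOfReal u) (NNReal.coe_pos.2 hη)
  rw [ENNReal.ofReal_coe_nnreal] at hp
  have hfp : Continuous fun h => f h - p h := by fun_prop
  refine ⟨p, ?_, fun A hA x => ?_⟩
  · calc ∫⁻ h, ‖f h - p h‖ₑ ∂mH
        ≤ ‖mT‖ₑ * η / (‖J 1‖ₑ * ∫⁻ t, ‖ccOfReal u t‖ₑ ∂mG) :=
          hJ.lintegral_enorm_le_of_continuous hJ1 hmT _ hu0 hfp ENNReal.coe_ne_top hp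
      _ = η * C := by rw [mul_comm, mul_div_assoc]
      _ ≤ ε := le_self_add.trans hηε.le
  · have hstrip : ∀ x, stripLIntegral ρ.variation (K - K) (fun h => ‖f h - p h‖ₑ) x ≤ η :=
      fun x => (lintegral_mono fun y => mul_le_mul_left
        (by simpa [← ofReal_norm] using hu.indicator_le_enorm (y.1 + x.1)) _).trans (hp x)
    calc stripLIntegral ρ.variation A (fun h => ‖f h - p h‖ₑ) x
        ≤ η * mG (A + K) / mG K :=
          (ENNReal.le_div_iff_mul_le (Or.inl hmK) (Or.inl hK.measure_ne_top)).2
            (stripLIntegral_mul_le hK hmK hfp.enorm.measurable hstrip hA x)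
      _ = η * (mG K)⁻¹ * mG (A + K) := by rw [div_eq_mul_inv, mul_right_comm]
      _ ≤ ε * mG (A + K) := mul_le_mul_left (le_add_self.trans hηε.le) _

theorem IsAdmissible.integrable [mH.Regular] (hfa : IsAdmissible ρ f) (hf : Continuous f)
    (hρ : ρ.IsInvariant S.lattice) (h0 : ρ.variation ≠ 0)
    (hmT : S.IsDisintegration (prodFunctional mG mH) mT) : Integrable f mH := by
  obtain ⟨K, hK, hK0, -⟩ := exists_symm_compact_nhds_zero (G := G)
  obtain ⟨p, hp, -⟩ := hfa.exists_cc_approx hf hρ h0 hmT hK hK0 one_ne_zero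
  have hfp : Continuous fun h => f h - p h := by fun_prop
  have hdiff : Integrable (fun h => f h - p h) mH :=
    ⟨hfp.aestronglyMeasurable, hp.trans_lt ENNReal.one_lt_top⟩
  exact (hdiff.add ((map_continuous p).integrable_of_hasCompactSupport
    p.hasCompactSupport)).congr (ae_of_all _ fun h => sub_add_cancel _ _)

theorem IsVanHove.integrable_muIntegrand_of_isAdmissible [mH.Regular] {B : ℕ → Set G}
    (hB : IsVanHove mG B) (hfa : IsAdmissible ρ f) (hf : Continuous f)
    (hρ : ρ.IsInvariant S.lattice) (h0 : ρ.variation ≠ 0)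
    (hmT : S.IsDisintegration (prodFunctional mG mH) mT) (n : ℕ) (x : G × H) :
    Integrable (muIntegrand f (B n) x) ρ.variation := by
  obtain ⟨K, hK, hK0, -⟩ := exists_symm_compact_nhds_zero (G := G)
  have hBK : mG (B n + K) ≠ ⊤ := hB.measure_add_ne_top hK n
  obtain ⟨p, -, hp⟩ := hfa.exists_cc_approx hf hρ h0 hmT hK hK0 one_ne_zero
  exact hB.integrable_muIntegrand_of_sub_cc hρ p
    (measurable_borel_of_continuous (by fun_prop)).aemeasurable
    (ne_top_of_le_ne_top (ENNReal.mul_ne_top ENNReal.one_ne_top hBK) (hp _ hBK x))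

theorem IsAdmissible.weylConvergence_of_variation_ne_zero [mH.Regular] (hfa : IsAdmissible ρ f)
    (hf : Continuous f) (hρ : ρ.IsInvariant S.lattice) (h0 : ρ.variation ≠ 0)
    {ρT : C(S.Torus, ℂ) →L[ℂ] ℂ} (hρT : S.IsDisintegration (fun g => ρ.integral g) ρT)
    (hmT : S.IsDisintegration (prodFunctional mG mH) mT) :
    WeylConvergence mG S ρ f (ρT 1 / mT 1 * ∫ h, f h ∂mH) := by
  obtain ⟨K, hK, hK0, -⟩ := exists_symm_compact_nhds_zero (G := G)
  refine weylConvergence_of_approx hρ hρT hmT (hfa.integrable hf hρ h0 hmT)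
    (fun _ hB => hB.integrable_muIntegrand_of_isAdmissible hfa hf hρ h0 hmT) fun B hB ε hε => ?_
  have hε2 : ENNReal.ofReal ε / 2 ≠ 0 := by simpa using hε
  obtain ⟨p, hpf, hpv⟩ := hfa.exists_cc_approx hf hρ h0 hmT hK hK0 hε2
  refine ⟨p, hpf.trans ENNReal.half_le_self, ?_⟩
  filter_upwards [hB.eventually_add_le hK one_ne_zero] with n hn x
  rw [one_add_one_eq_two] at hn
  calc stripLIntegral ρ.variation (B n) (fun h => ‖f h - p h‖ₑ) x
      ≤ ENNReal.ofReal ε / 2 * mG (B n + K) := hpv _ (hB.measure_add_ne_top hK n) x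
    _ ≤ ENNReal.ofReal ε / 2 * (2 * mG (B n)) := mul_le_mul_right hn _
    _ = ENNReal.ofReal ε * mG (B n) := by
      rw [← mul_assoc, ENNReal.div_mul_cancel two_ne_zero ENNReal.ofNat_ne_top]

end Admissible

section VariationZero

variable {G H : Type*} [AddCommGroup G] [TopologicalSpace G] [AddCommGroup H] [TopologicalSpace H]
  {S : CutProjectScheme G H} {ρ : ComplexRadonMeasure (G × H)}

theorem weylConvergence_zero_of_variation_eq_zero [MeasurableSpace G] (mG : Measure G)
    (S : CutProjectScheme G H) (h0 : ρ.variation = 0) (f : H → ℂ) :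
    WeylConvergence mG S ρ f 0 := by
  intro B _
  refine ⟨fun n x => ?_, fun _ _ => 0, fun n x => (ρ.integral_of_variation_eq_zero h0 _).symm, ?_⟩
  · rw [ComplexRadonMeasure.IntegrableFun, h0]
    exact integrable_zero_measure
  · simp only [zero_div]
    exact fun u hu => Eventually.of_forall fun _ _ => refl_mem_uniformity hu

theorem CutProjectScheme.IsDisintegration.apply_one_eq_zero [IsTopologicalAddGroup G]
    [LocallyCompactSpace G] [T2Space G] [IsTopologicalAddGroup H] [LocallyCompactSpace H]
    [T2Space H] {ρT : C(S.Torus, ℂ) →L[ℂ] ℂ}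
    (hρT : S.IsDisintegration (fun g => ρ.integral g) ρT) (h0 : ρ.variation = 0) : ρT 1 = 0 := by
  obtain ⟨w, -, hw⟩ := S.exists_cosetSumMap_ccOfReal_eq_one
  exact (hρT.apply_one hw).trans (ρ.integral_of_variation_eq_zero h0 _)

end VariationZero

section Riemann

theorem ae_eq_iSup_of_tendsto_integral_sub {X : Type*} {m : MeasurableSpace X} {μ : Measure X}
    {f : X → ℝ} {φ ψ : ℕ → X → ℝ} (hφ : ∀ n, Integrable (φ n) μ) (hψ : ∀ n, Integrable (ψ n) μ)
    (hle : ∀ n x, φ n x ≤ f x ∧ f x ≤ ψ n x)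
    (hlim : Tendsto (fun n => ∫ x, (ψ n x - φ n x) ∂μ) atTop (𝓝 0)) :
    f =ᵐ[μ] fun x => ⨆ n, φ n x := by
  have hgap : ∀ᵐ x ∂μ, ⨅ n, ENNReal.ofReal (ψ n x - φ n x) = 0 := by
    refine (lintegral_eq_zero_iff' (AEMeasurable.iInf fun n =>
      ((hψ n).sub (hφ n)).aemeasurable.ennreal_ofReal)).1 (le_antisymm ?_ zero_le)
    have hlim' := ENNReal.tendsto_ofReal hlim
    rw [ENNReal.ofReal_zero] at hlim'
    refine ge_of_tendsto' hlim' fun n => (lintegral_mono fun x => iInf_le _ n).trans_eq ?_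
    exact (ofReal_integral_eq_lintegral_ofReal ((hψ n).sub (hφ n))
      (ae_of_all _ fun x => sub_nonneg.2 ((hle n x).1.trans (hle n x).2))).symm
  filter_upwards [hgap] with x hx
  have hbdd : BddAbove (range fun n => φ n x) := ⟨f x, forall_mem_range.2 fun n => (hle n x).1⟩
  refine le_antisymm (le_of_forall_pos_le_add fun ε hε => ?_) (ciSup_le fun n => (hle n x).1)
  obtain ⟨n, hn⟩ := iInf_lt_iff.1 (hx.trans_lt (ENNReal.ofReal_pos.2 hε))
  have hgap_lt : ψ n x - φ n x < ε := (ENNReal.ofReal_lt_ofReal_iff hε).1 hn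
  linarith [le_ciSup hbdd n, (hle n x).2]

theorem IsRiemannIntegrable.integrable {H : Type*} [TopologicalSpace H] [R1Space H]
    [MeasurableSpace H] [BorelSpace H] {mH : Measure H} [IsFiniteMeasureOnCompacts mH] {f : H → ℝ}
    (hf : IsRiemannIntegrable mH f) : Integrable f mH := by
  have hcc : ∀ p : C_c(H, ℝ), Integrable p mH := fun p =>
    (map_continuous p).integrable_of_hasCompactSupport p.hasCompactSupport
  choose φ ψ hle hint using fun n : ℕ => hf (1 / (n + 1)) Nat.one_div_pos_of_nat
  have hlim : Tendsto (fun n => ∫ h, (ψ n h - φ n h) ∂mH) atTop (𝓝 0) :=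
    squeeze_zero (fun n => integral_nonneg fun h => sub_nonneg.2 ((hle n h).1.trans (hle n h).2))
      hint tendsto_one_div_add_atTop_nhds_zero_nat
  have hmeas : AEStronglyMeasurable f mH :=
    (Measurable.iSup fun n => (map_continuous (φ n)).measurable).aestronglyMeasurable.congr
      (ae_eq_iSup_of_tendsto_integral_sub (fun n => hcc (φ n)) (fun n => hcc (ψ n)) hle hlim).symm
  exact ((hcc (φ 0)).norm.add (hcc (ψ 0)).norm).mono' hmeas (ae_of_all _ fun h =>
    (abs_le_max_abs_abs (hle 0 h).1 (hle 0 h).2).trans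
      (max_le_add_of_nonneg (abs_nonneg _) (abs_nonneg _)))

theorem IsRiemannIntegrable.exists_cc_approx {H : Type*} [TopologicalSpace H] [MeasurableSpace H]
    {mH : Measure H} {f : H → ℝ} (hf : IsRiemannIntegrable mH f) {ε : ℝ} (hε : 0 < ε) :
    ∃ φ d : C_c(H, ℝ), (∀ h, 0 ≤ d h) ∧
      (∀ h, ‖(f h : ℂ) - ccOfReal φ h‖ₑ ≤ ‖d h‖ₑ) ∧ ∫ h, d h ∂mH ≤ ε := by
  obtain ⟨φ, ψ, hle, hint⟩ := hf ε hε
  refine ⟨φ, ψ - φ, fun h => sub_nonneg.2 ((hle h).1.trans (hle h).2), fun h => ?_, hint⟩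
  rw [enorm_le_iff_norm_le, ccOfReal_apply, ← Complex.ofReal_sub, Complex.norm_real]
  exact abs_le_abs_of_nonneg (sub_nonneg.2 (hle h).1) (sub_le_sub_right (hle h).2 _)

theorem ComplexRadonMeasure.IsPositive.integral_eq {X : Type*} [TopologicalSpace X]
    {ρ : ComplexRadonMeasure X} (hpos : ρ.IsPositive) (F : X → ℂ) :
    ρ.integral F = ∫ x, F x ∂ρ.variation :=
  integral_congr_ae (hpos.mono fun x hx => by simp only [hx, mul_one])

theorem ComplexRadonMeasure.IsPositive.enorm_integral_muIntegrand {G H : Type*} [AddCommGroup G]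
    [TopologicalSpace G] [AddCommGroup H] [TopologicalSpace H] {ρ : ComplexRadonMeasure (G × H)}
    (hpos : ρ.IsPositive) {d : H → ℝ} (hd : ∀ h, 0 ≤ d h) {A : Set G} {x : G × H}
    (hint : Integrable (muIntegrand (fun h => (d h : ℂ)) A x) ρ.variation) :
    ‖ρ.integral (muIntegrand (fun h => (d h : ℂ)) A x)‖ₑ =
      stripLIntegral ρ.variation A (fun h => ‖d h‖ₑ) x := by
  have hnorm : ∀ y, ((‖muIntegrand (fun h => (d h : ℂ)) A x y‖ : ℝ) : ℂ) =
      muIntegrand (fun h => (d h : ℂ)) A x y := fun y => by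
    by_cases hy : y.1 + x.1 ∈ A <;> simp [muIntegrand, hy, abs_of_nonneg (hd _)]
  have hstrip := lintegral_enorm_muIntegrand ρ.variation (fun h => (d h : ℂ)) A x
  rw [← enorm_integral_ofReal_norm hint] at hstrip
  simpa [hnorm, hpos.integral_eq, ← ofReal_norm] using hstrip

variable {G H : Type*} [AddCommGroup G] [TopologicalSpace G] [IsTopologicalAddGroup G]
  [LocallyCompactSpace G] [T2Space G] [MeasurableSpace G] [BorelSpace G]
  [AddCommGroup H] [TopologicalSpace H] [IsTopologicalAddGroup H]
  [LocallyCompactSpace H] [T2Space H] [MeasurableSpace H] [BorelSpace H]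
  {S : CutProjectScheme G H} {ρ : ComplexRadonMeasure (G × H)}
  {mG : Measure G} [mG.IsAddHaarMeasure] {mH : Measure H} [mH.IsAddHaarMeasure]
  {ρT mT : C(S.Torus, ℂ) →L[ℂ] ℂ}

theorem ComplexRadonMeasure.IsPositive.eventually_stripLIntegral_le (hpos : ρ.IsPositive)
    (hρ : ρ.IsInvariant S.lattice) (hρT : S.IsDisintegration (fun g => ρ.integral g) ρT)
    (hmT : S.IsDisintegration (prodFunctional mG mH) mT) {B : ℕ → Set G} (hB : IsVanHove mG B)
    {d : C_c(H, ℝ)} (hd : ∀ h, 0 ≤ d h) {c : ℝ} (hc : ‖ρT 1 / mT 1‖ * ∫ h, d h ∂mH < c) :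
    ∀ᶠ n in atTop, ∀ x,
      stripLIntegral ρ.variation (B n) (fun h => ‖d h‖ₑ) x ≤ ENNReal.ofReal c * mG (B n) := by
  have hcoe : ⇑(ccOfReal d) = fun h => (d h : ℂ) := funext (ccOfReal_apply d)
  have hlim := tendstoUniformly_integral_muIntegrand_cc hρ hρT hmT hB (ccOfReal d)
  have hnorm : ‖ρT 1 / mT 1 * ∫ h, ccOfReal d h ∂mH‖ = ‖ρT 1 / mT 1‖ * ∫ h, d h ∂mH := by
    simp only [ccOfReal_apply]
    rw [norm_mul, integral_complex_ofReal, Complex.norm_real,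
      Real.norm_of_nonneg (integral_nonneg hd)]
  filter_upwards [Metric.tendstoUniformly_iff.1 hlim _ (sub_pos.2 (hnorm.trans_lt hc))] with n hn x
  have hm : 0 < mG.real (B n) := ENNReal.toReal_pos (hB.pos n).ne' (hB.measure_ne_top n)
  have hc' : ‖ρ.integral (muIntegrand (ccOfReal d) (B n) x)‖ ≤ c * mG.real (B n) := by
    rw [← div_le_iff₀ hm, ← Real.norm_of_nonneg hm.le, ← Complex.norm_real, ← norm_div]
    have := norm_le_norm_add_norm_sub (ρT 1 / mT 1 * ∫ h, ccOfReal d h ∂mH)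
      (ρ.integral (muIntegrand (ccOfReal d) (B n) x) / (mG.real (B n) : ℂ))
    have := hn x
    rw [dist_eq_norm] at this
    linarith
  calc stripLIntegral ρ.variation (B n) (fun h => ‖d h‖ₑ) x
      = ‖ρ.integral (muIntegrand (ccOfReal d) (B n) x)‖ₑ := by
        have hint := hB.integrable_muIntegrand_cc hρ (ccOfReal d) n x
        rw [hcoe] at hint ⊢
        exact (hpos.enorm_integral_muIntegrand hd hint).symm
    _ ≤ ENNReal.ofReal (c * mG.real (B n)) := by
        rw [← ofReal_norm]
        exact ENNReal.ofReal_le_ofReal hc'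
    _ = ENNReal.ofReal c * mG (B n) := by
        rw [ENNReal.ofReal_mul' hm.le, ofReal_measureReal (hB.measure_ne_top n)]

theorem IsRiemannIntegrable.weylConvergence {f : H → ℝ} (hf : IsRiemannIntegrable mH f)
    (hmeas : ∀ k : H, @AEMeasurable (G × H) ℝ _ (borel (G × H))
      (fun x => f (x.2 + k)) ρ.variation)
    (hpos : ρ.IsPositive) (hρ : ρ.IsInvariant S.lattice)
    (hρT : S.IsDisintegration (fun g => ρ.integral g) ρT)
    (hmT : S.IsDisintegration (prodFunctional mG mH) mT) :
    WeylConvergence mG S ρ (fun h => (f h : ℂ)) (ρT 1 / mT 1 * (∫ h, f h ∂mH : ℝ)) := by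
  rw [← integral_complex_ofReal]
  refine weylConvergence_of_approx hρ hρT hmT hf.integrable.ofReal (fun B hB n x => ?_)
    fun B hB ε hε => ?_
  · obtain ⟨φ, d, -, hfd, -⟩ := hf.exists_cc_approx one_pos
    have hd := (hB.integrable_muIntegrand_cc hρ (ccOfReal d) n x).2.ne
    rw [lintegral_enorm_muIntegrand] at hd
    exact hB.integrable_muIntegrand_of_sub_cc hρ (ccOfReal φ)
      (Complex.measurable_ofReal.comp_aemeasurable (hmeas x.2))
      (ne_top_of_le_ne_top hd (stripLIntegral_mono subset_rfl
        (fun h => (hfd h).trans_eq (by simp [← ofReal_norm])) x))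
  set a := ‖ρT 1 / mT 1‖
  obtain ⟨φ, d, hd0, hfd, hdε⟩ := hf.exists_cc_approx (ε := ε / (a + 1)) (by positivity)
  have hd : a * ∫ h, d h ∂mH < ε := calc
    a * ∫ h, d h ∂mH ≤ a * (ε / (a + 1)) := by gcongr
    _ < (a + 1) * (ε / (a + 1)) := by gcongr; exact lt_add_one a
    _ = ε := mul_div_cancel₀ _ (by positivity)
  refine ⟨ccOfReal φ, (lintegral_mono hfd).trans ?_, ?_⟩
  · rw [← ofReal_integral_norm_eq_lintegral_enorm
      ((map_continuous d).integrable_of_hasCompactSupport d.hasCompactSupport)]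
    simp only [Real.norm_of_nonneg (hd0 _)]
    exact ENNReal.ofReal_le_ofReal
      (hdε.trans (div_le_self hε.le (le_add_of_nonneg_left (norm_nonneg _))))
  · filter_upwards [hpos.eventually_stripLIntegral_le hρ hρT hmT hB hd0 hd] with n hn x
    exact (stripLIntegral_mono subset_rfl hfd x).trans (hn x)

end Riemann

theorem mainTheorem5_general {G H : Type*}
    [AddCommGroup G] [TopologicalSpace G] [IsTopologicalAddGroup G] [LocallyCompactSpace G]
    [T2Space G] [MeasurableSpace G] [BorelSpace G]
    [AddCommGroup H] [TopologicalSpace H] [IsTopologicalAddGroup H] [LocallyCompactSpace H]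
    [T2Space H] [MeasurableSpace H] [BorelSpace H]
    (mG : Measure G) [mG.IsAddHaarMeasure]
    (mH : Measure H) [mH.IsAddHaarMeasure] [mH.Regular]
    (S : CutProjectScheme G H) (ρ : ComplexRadonMeasure (G × H))
    (hρ : ρ.IsInvariant S.lattice) :
    (∃! ρT : C(S.Torus, ℂ) →L[ℂ] ℂ, S.IsDisintegration (fun g => ρ.integral g) ρT) ∧
    (∃! mT : C(S.Torus, ℂ) →L[ℂ] ℂ, S.IsDisintegration (prodFunctional mG mH) mT) ∧
    ∀ ρT mT : C(S.Torus, ℂ) →L[ℂ] ℂ,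
      S.IsDisintegration (fun g => ρ.integral g) ρT →
      S.IsDisintegration (prodFunctional mG mH) mT →
      mT 1 ≠ 0 ∧
      (∀ f : C_c(H, ℂ),
        WeylConvergence mG S ρ f (ρT 1 / mT 1 * ∫ h, f h ∂mH)) ∧
      (∀ f : H → ℂ, Continuous f → IsAdmissible ρ f →
        (ρ.variation ≠ 0 → Integrable f mH) ∧
        WeylConvergence mG S ρ f (ρT 1 / mT 1 * ∫ h, f h ∂mH)) ∧
      (ρ.IsPositive → ∀ f : H → ℝ, IsRiemannIntegrable mH f →
        (∀ k : H, @AEMeasurable (G × H) ℝ _ (borel (G × H))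
          (fun x => f (x.2 + k)) ρ.variation) →
        Integrable f mH ∧
        WeylConvergence mG S ρ (fun h => (f h : ℂ)) (ρT 1 / mT 1 * ∫ h, f h ∂mH)) := by
  refine ⟨hρ.existsUnique_isDisintegration, S.existsUnique_isDisintegration_prodFunctional mG mH,
    fun ρT mT hρT hmT => ⟨hmT.prodFunctional_apply_one_ne_zero, weylConvergence_cc hρ hρT hmT,
      fun f hf hfa => ⟨fun h0 => hfa.integrable hf hρ h0 hmT, ?_⟩,
      fun hpos f hf hmeas => ⟨hf.integrable, hf.weylConvergence hmeas hpos hρ hρT hmT⟩⟩⟩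
  by_cases h0 : ρ.variation = 0
  · rw [hρT.apply_one_eq_zero h0, zero_div, zero_mul]
    exact weylConvergence_zero_of_variation_eq_zero mG S h0 f
  · exact hfa.weylConvergence_of_variation_ne_zero hf hρ h0 hρT hmT

theorem mainTheorem5 {G H : Type*}
    [AddCommGroup G] [TopologicalSpace G] [IsTopologicalAddGroup G] [LocallyCompactSpace G]
    [SigmaCompactSpace G] [T2Space G] [MeasurableSpace G] [BorelSpace G]
    [AddCommGroup H] [TopologicalSpace H] [IsTopologicalAddGroup H] [LocallyCompactSpace H]
    [SigmaCompactSpace H] [T2Space H] [MeasurableSpace H] [BorelSpace H]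
    (mG : Measure G) [mG.IsAddHaarMeasure] [mG.Regular]
    (mH : Measure H) [mH.IsAddHaarMeasure] [mH.Regular]
    (S : CutProjectScheme G H) (ρ : ComplexRadonMeasure (G × H))
    (hρ : ρ.IsInvariant S.lattice) :
    (∃! ρT : C(S.Torus, ℂ) →L[ℂ] ℂ, S.IsDisintegration (fun g => ρ.integral g) ρT) ∧
    (∃! mT : C(S.Torus, ℂ) →L[ℂ] ℂ, S.IsDisintegration (prodFunctional mG mH) mT) ∧
    ∀ ρT mT : C(S.Torus, ℂ) →L[ℂ] ℂ,
      S.IsDisintegration (fun g => ρ.integral g) ρT →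
      S.IsDisintegration (prodFunctional mG mH) mT →
      mT 1 ≠ 0 ∧
      (∀ f : C_c(H, ℂ),
        WeylConvergence mG S ρ f (ρT 1 / mT 1 * ∫ h, f h ∂mH)) ∧
      (∀ f : H → ℂ, Continuous f → IsAdmissible ρ f →
        (ρ.variation ≠ 0 → Integrable f mH) ∧
        WeylConvergence mG S ρ f (ρT 1 / mT 1 * ∫ h, f h ∂mH)) ∧
      (ρ.IsPositive → ∀ f : H → ℝ, IsRiemannIntegrable mH f →
        (∀ k : H, @AEMeasurable (G × H) ℝ _ (borel (G × H))
          (fun x => f (x.2 + k)) ρ.variation) →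
        Integrable f mH ∧
        WeylConvergence mG S ρ (fun h => (f h : ℂ)) (ρT 1 / mT 1 * ∫ h, f h ∂mH)) := by
  exact mainTheorem5_general mG mH S ρ hρ
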